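/- Let $N,m,d\ge 2$ be integers and $\omega=e^{2\pi \mathrm{i}/d}$. Consider $N$ parties $A_1,\dots,A_N$ and an eavesdropper Eve. A *quantum realization* consists of finite-dimensional Hilbert spaces $\mathcal H_1,\dots,\mathcal H_N$ (of arbitrary dimensions), a Hilbert space $\mathcal H_E$, a unit vector $|\psi\rangle\in\mathcal H_1\otimes\cdots\otimes\mathcal H_N\otimes\mathcal H_E$ and, for each party $i$ and each setting $x\in\{1,\dots,m\}$, a $d$-outcome projective measurement $\{Q_{i,x}^{(b)}\}_{b=0}^{d-1}$ on $\mathcal H_i$. Its correlations are $p(b_1,\dots,b_N|x_1,\dots,x_N)=\langle\psi|Q_{1,x_1}^{(b_1)}\otimes\cdots\otimes Q_{N,x_N}^{(b_N)}\otimes\mathbb 1_E|\psi\rangle$, and its observables are $A_{i,x}=\sum_{b}\omega^bQ_{i,x}^{(b)}$, extended by $A_{i,x+m}=\omega A_{i,x}$. The ASTA Bell expression is $$\mathcal B_{m,d,N}=\sum_{\alpha_1,\dots,\alpha_{N-1}=1}^m\ \sum_{k=1}^{d-1}\Big\langle\big(a_kA_{1,\alpha_1}^k+a_k^*A_{1,\alpha_1+1}^k\big)\otimes\bigotimes_{i=2}^NA_{i,\alpha_{i-1}+\alpha_i-1}^{(-1)^{i-1}k}\Big\rangle,\qquad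 a_k=\frac{\omega^{(2k-d)/4m}}{2\cos(\pi/2m)},\quad \alpha_N=1,$$ where $\langle X\rangle=\langle\psi|X\otimes\mathbb 1_E|\psi\rangle$. The ASTA Bell inequality is *maximally violated* by a realization if $\mathcal B_{m,d,N}$ takes on it its largest value over all quantum realizations. For correlations $\vec p$, a party $i$ and a setting $x$, Eve's local guessing probability is $$G_i(x,\vec p)=\sup\ \sum_{b=0}^{d-1}\langle\psi|Q_{i,x}^{(b)}\otimes E^{(b)}|\psi\rangle$$ (with identities on the other parties), where the supremum is over all quantum realizations with correlations $\vec p$ and all $d$-outcome quantum measurements (POVMs) $\{E^{(b)}\}$ on the Eve space of the realization. **Theorem.** If $\vec p$ are the correlations of a quantum realization that maximally violates the ASTA Bell inequality, then for every party $i$ and every setting $x\in\{1,\dots,m\}$ $$G_i(x,\vec p)=\frac1d,\qquad\text{and hence}\qquad -\log_2G_i(x,\vec p)=\log_2 d$$ bits of device-independent randomness are certified. -/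

import Mathlib

universe u

noncomputable section

namespace ASTA

open scoped ComplexConjugate

/-- A quantum realization of the Bell scenario with `N` parties, `m` settings per party and `d`
outcomes per measurement, in the presence of an eavesdropper. Party `i` holds the Hilbert space
`ℂ ^ dim i`, the eavesdropper an arbitrary complex Hilbert space `Eve`. The shared pure state is a
unit vector of `ℂ ^ dim 1 ⊗ ⋯ ⊗ ℂ ^ dim N ⊗ Eve`, written in the product basis of the parties, i.e.
as an `Eve`-valued function of the multi-index `j = (j₁, …, j_N)`. For each party `i` and setting `x`,
`Q i x` is a `d`-outcome projective measurement (projections which sum to the identity; they are then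
mutually orthogonal). Parties, settings and outcomes are numbered from `0`. -/
structure Realization (N m d : ℕ) where
  dim : Fin N → ℕ
  Eve : Type u
  [normedAddCommGroupEve : NormedAddCommGroup Eve]
  [innerProductSpaceEve : InnerProductSpace ℂ Eve]
  [completeSpaceEve : CompleteSpace Eve]
  state : PiLp 2 (fun _ : (∀ i, Fin (dim i)) => Eve)
  norm_state : ‖state‖ = 1
  Q : ∀ i : Fin N, Fin m → Fin d → Matrix (Fin (dim i)) (Fin (dim i)) ℂ
  isHermitian_Q : ∀ i x b, (Q i x b).IsHermitian
  idempotent_Q : ∀ i x b, Q i x b * Q i x b = Q i x b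
  sum_Q : ∀ i x, ∑ b, Q i x b = 1

attribute [instance] Realization.normedAddCommGroupEve Realization.innerProductSpaceEve
  Realization.completeSpaceEve

/-- `ω ^ r` for `ω = exp (2πi / d)` and a real exponent `r`. -/
def omegaPow (d : ℕ) (r : ℝ) : ℂ :=
  Complex.exp (2 * Real.pi * Complex.I / d * r)

/-- The coefficient `a_k = ω ^ ((2k - d) / 4m) / (2 cos (π / 2m))`. -/
def coeffA (m d k : ℕ) : ℂ :=
  omegaPow d ((2 * (k : ℝ) - d) / (4 * m)) / ((2 * Real.cos (Real.pi / (2 * m)) : ℝ) : ℂ)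

/-- The entry `α_{j+1}` (shifted to start from `0`) of `(α_1, …, α_{N-1}, α_N)`, where the last entry
`α_N` is fixed to be the first setting. -/
def settingIndex {N m : ℕ} (α : Fin (N - 1) → Fin m) (j : ℕ) : ℕ :=
  if h : j < N - 1 then (α ⟨j, h⟩ : ℕ) else 0

namespace Realization

variable {N m d : ℕ} (S : Realization.{u} N m d)

/-- The action of `M 1 ⊗ ⋯ ⊗ M N ⊗ 𝟙` on `ℂ ^ dim 1 ⊗ ⋯ ⊗ ℂ ^ dim N ⊗ Eve`. -/
def applyParties (M : ∀ i, Matrix (Fin (S.dim i)) (Fin (S.dim i)) ℂ)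
    (v : PiLp 2 (fun _ : (∀ i, Fin (S.dim i)) => S.Eve)) :
    PiLp 2 (fun _ : (∀ i, Fin (S.dim i)) => S.Eve) :=
  WithLp.toLp 2 fun j => ∑ l, (∏ i, M i (j i) (l i)) • v l

/-- The action of `𝟙 ⊗ ⋯ ⊗ 𝟙 ⊗ E` on `ℂ ^ dim 1 ⊗ ⋯ ⊗ ℂ ^ dim N ⊗ Eve`. -/
def applyEve (E : S.Eve →L[ℂ] S.Eve)
    (v : PiLp 2 (fun _ : (∀ i, Fin (S.dim i)) => S.Eve)) :
    PiLp 2 (fun _ : (∀ i, Fin (S.dim i)) => S.Eve) :=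
  WithLp.toLp 2 fun j => E (v j)

/-- The expectation value `⟨M 1 ⊗ ⋯ ⊗ M N⟩` in the shared state. -/
def expectation (M : ∀ i, Matrix (Fin (S.dim i)) (Fin (S.dim i)) ℂ) : ℂ :=
  inner ℂ S.state (S.applyParties M S.state)

/-- The observed correlations: `S.behaviour x b` is the probability that the parties obtain the
outcomes `b` when they choose the settings `x`. -/
def behaviour (x : Fin N → Fin m) (b : Fin N → Fin d) : ℝ :=
  (S.expectation fun i => S.Q i (x i) (b i)).re

/-- The unitary observable `A_{i,x} = ∑_b ω ^ b Q_{i,x}^{(b)}` of a projective measurement. -/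
def observable (i : Fin N) (x : Fin m) : Matrix (Fin (S.dim i)) (Fin (S.dim i)) ℂ :=
  ∑ b : Fin d, omegaPow d (b : ℕ) • S.Q i x b

/-- The observables for all settings `x ∈ ℕ` (numbered from `0`), with the convention
`A_{i,x+m} = ω A_{i,x}`. -/
def extObservable (i : Fin N) (x : ℕ) : Matrix (Fin (S.dim i)) (Fin (S.dim i)) ℂ :=
  if h : 0 < m then omegaPow d (x / m : ℕ) • S.observable i ⟨x % m, Nat.mod_lt x h⟩ else 0

/-- The local factors of the term of the ASTA expression with indices `α` and `k`: the first party
contributes `a_k A_{1,α_1}^k + a_k^* A_{1,α_1+1}^k` and party `i ≥ 2` contributes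
`A_{i,α_{i-1}+α_i-1}^{(-1)^{i-1} k}`, in the numbering from `1`. -/
def astaFactor (α : Fin (N - 1) → Fin m) (k : ℕ) (i : Fin N) :
    Matrix (Fin (S.dim i)) (Fin (S.dim i)) ℂ :=
  if (i : ℕ) = 0 then
    coeffA m d k • S.extObservable i (settingIndex α 0) ^ k +
      conj (coeffA m d k) • S.extObservable i (settingIndex α 0 + 1) ^ k
  else
    S.extObservable i (settingIndex α ((i : ℕ) - 1) + settingIndex α i) ^
      ((-1 : ℤ) ^ (i : ℕ) * (k : ℤ))

/-- The value of the ASTA Bell expression. The terms for `k` and `d - k` are complex conjugates of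
each other, so that the sum is real. -/
def astaValue : ℝ :=
  (∑ α : Fin (N - 1) → Fin m, ∑ k ∈ Finset.Ico 1 d, S.expectation (S.astaFactor α k)).re

/-- The ASTA Bell inequality is maximally violated: its value is the largest one that any quantum
realization (of any local dimensions) attains. -/
def MaximallyViolates : Prop :=
  ∀ T : Realization.{u} N m d, T.astaValue ≤ S.astaValue

/-- `E` is a `d`-outcome quantum measurement (POVM) of the eavesdropper. -/
def IsEvePOVM (E : Fin d → S.Eve →L[ℂ] S.Eve) : Prop :=
  (∀ b, (E b).IsPositive) ∧ ∑ b, E b = 1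

/-- The probability `∑_b ⟨ψ| Q_{i,x}^{(b)} ⊗ E^{(b)} |ψ⟩` that the outcome of the eavesdropper's
measurement `E` agrees with the outcome of the measurement `x` of party `i`. -/
def guessValue (i : Fin N) (x : Fin m) (E : Fin d → S.Eve →L[ℂ] S.Eve) : ℝ :=
  ∑ b : Fin d, (inner ℂ S.state
    (S.applyParties (Pi.mulSingle i (S.Q i x b)) (S.applyEve (E b) S.state))).re

end Realization

/-- The local guessing probability `G` for the measurement `x` of party `i` given the observed
correlations `p`: the supremum over all strategies of the eavesdropper (a realization, i.e. Hilbert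
spaces, a shared state and measurements of the parties, that reproduces `p`, together with a
measurement on her own system). -/
def guessingProbability {N m d : ℕ} (i : Fin N) (x : Fin m)
    (p : (Fin N → Fin m) → (Fin N → Fin d) → ℝ) : ℝ :=
  sSup {g : ℝ | ∃ T : Realization.{u} N m d, T.behaviour = p ∧
    ∃ E : Fin d → T.Eve →L[ℂ] T.Eve, T.IsEvePOVM E ∧ g = T.guessValue i x E}

/-- The number of certified random bits: the min-entropy `-log₂ G`. -/
def certifiedBits {N m d : ℕ} (i : Fin N) (x : Fin m)
    (p : (Fin N → Fin m) → (Fin N → Fin d) → ℝ) : ℝ :=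
  -Real.logb 2 (guessingProbability.{u} i x p)

end ASTA

end

-- The value $1/d$ is a tracelessness statement: at maximal violation $\langle\psi|A_{i,x}^k\otimes
-- E|\psi\rangle=0$ for $0<k<d$ and every operator $E$ of Eve (`inner_partyOp_eq_zero`). Fourier
-- inversion then gives $\langle Q^{(b)}\otimes E^{(b)}\rangle=\langle E^{(b)}\rangle/d$, and
-- summing over $b$ gives $1/d$ (`guessValue_eq`).
--
-- The maximal value comes from a sum of squares. `astaValue_add_defect` writes $m^{N-1}(d-1)$ minus
-- the Bell value as a sum of nonnegative defects: distances between vectors of the first party and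
-- of the remaining parties, and gaps in an inequality for antiperiodic chains of unit vectors
-- (`chain_sum_identity`). The GHZ state has no defect (`ghz_astaValue`), so maximal violation makes
-- all defects vanish. With $A,B$ the inverses of neighbouring observables of the first party and
-- $X,Y$ unitaries of the rest, this says that $X^k=a_k^*A^k+a_kB^k$ and $B^k=a_k^*X^k+a_kY^k$ on
-- $\psi$ (`cut_relations`). Suitable index families yield the same relations for the cut between
-- any other party and its complement.
--
-- These relations hold only on $\psi$. They become operator identities on the cyclic module
-- $C\psi$, where $C$ is the commutant of $A,B$. There $w\mapsto\langle\psi,F\,w\psi\rangle$ is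
-- tracial with respect to $A$ and $U=a_1^*A+a_1B$, because both act on $\psi$ like elements of $C$
-- (`inner_pow_eq_zero_of_relation`). The rest is algebra (`trace_pow_eq_zero_of_quadratic`): after
-- rescaling $U$, every $W_k=A^{-k}U^k$ satisfies $(W_k-1)(W_k-q)=0$. This forces the $d$ conjugates
-- $A^{-j}PA^j$ of one idempotent to sum to $1$, with $PA^kP=0$ for $0<k<d$, and traciality kills
-- $A^k$.
--
-- The Bell value depends only on the correlations (`astaValue_congr`), so the argument covers every
-- realization available to Eve.

noncomputable section

namespace ASTA

open scoped ComplexConjugate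

-- Idempotents, quadratic relations and tracial functionals

section Ring

variable {R : Type*} [Ring R] [Algebra ℂ R]

/-- The inverse of $1+\eta x$ is $1+\kappa x$ for idempotent $x$. Expanding the hypothesis and its
inverse, where the factors swap, gives $\eta\,p'p=\kappa\,pp'$. Multiplying by $p$ on either side
yields $(\eta-\kappa)\,pp'p=0$, and then both products vanish. -/
theorem orthogonal_of_isIdempotentElem {η κ : ℂ} (hηκ : (1 + η) * (1 + κ) = 1) (hne : η ≠ κ)
    (hη : η ≠ 0) (hκ : κ ≠ 0) {p p' s : R} (hp : p * p = p) (hp' : p' * p' = p') (hs : s * s = s)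
    (h : 1 + η • s = (1 + η • p') * (1 + η • p)) : p * p' = 0 ∧ p' * p = 0 := by
  have hinv : ∀ x : R, x * x = x →
      (1 + η • x) * (1 + κ • x) = 1 ∧ (1 + κ • x) * (1 + η • x) = 1 := by
    intro x hx
    have h0 : η + κ + η * κ = 0 := by linear_combination hηκ
    constructor
    · have : (1 + η • x) * (1 + κ • x) = 1 + (η + κ + η * κ) • x := by
        simp only [mul_add, add_mul, mul_one, one_mul, smul_mul_smul_comm, hx, add_smul]
        abel
      rw [this, h0, zero_smul, add_zero]
    · have : (1 + κ • x) * (1 + η • x) = 1 + (η + κ + η * κ) • x := by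
        simp only [mul_add, add_mul, mul_one, one_mul, smul_mul_smul_comm, hx, add_smul,
          mul_comm κ η]
        abel
      rw [this, h0, zero_smul, add_zero]
  have h2 : 1 + κ • s = (1 + κ • p) * (1 + κ • p') := by
    have e : (1 + κ • p) * (1 + κ • p') * (1 + η • s) = 1 := by
      rw [h, mul_assoc, ← mul_assoc (1 + κ • p'), (hinv p' hp').2, one_mul, (hinv p hp).2]
    calc 1 + κ • s = (1 + κ • p) * (1 + κ • p') * (1 + η • s) * (1 + κ • s) := by rw [e, one_mul]
      _ = _ := by rw [mul_assoc, (hinv s hs).1, mul_one]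
  have e1 : s = p' + p + η • (p' * p) := by
    have : η • s = η • (p' + p + η • (p' * p)) := by
      have := h
      simp only [mul_add, add_mul, mul_one, one_mul, smul_mul_smul_comm] at this
      rw [smul_add, smul_add, smul_smul]
      have := congrArg (fun x => x - 1) this
      simp only [add_sub_cancel_left] at this
      rw [this]; abel
    exact smul_right_injective R hη this
  have e2 : s = p + p' + κ • (p * p') := by
    have : κ • s = κ • (p + p' + κ • (p * p')) := by
      have := h2
      simp only [mul_add, add_mul, mul_one, one_mul, smul_mul_smul_comm] at this
      rw [smul_add, smul_add, smul_smul]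
      have := congrArg (fun x => x - 1) this
      simp only [add_sub_cancel_left] at this
      rw [this]; abel
    exact smul_right_injective R hκ this
  have e3 : η • (p' * p) = κ • (p * p') := by
    have := e1.symm.trans e2
    rw [add_comm p p'] at this
    exact add_left_cancel this
  have e4 : η • (p * p' * p) = κ • (p * p') := by
    have := congrArg (fun x => p * x) e3
    simpa only [mul_smul_comm, ← mul_assoc, hp] using this
  have e5 : η • (p' * p) = κ • (p * p' * p) := by
    have := congrArg (fun x => x * p) e3
    simpa only [smul_mul_assoc, mul_assoc, hp] using this
  have e6 : (η - κ) • (p * p' * p) = 0 := by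
    rw [sub_smul, e4, ← e5, e3, sub_self]
  have e7 : p * p' * p = 0 := (smul_eq_zero.mp e6).resolve_left (sub_ne_zero.mpr hne)
  rw [e7, smul_zero] at e4 e5
  exact ⟨(smul_eq_zero.mp e4.symm).resolve_left hκ, (smul_eq_zero.mp e5).resolve_left hη⟩

/-- If `A` has order `d`, `U ^ d = q` and each `A ^ (-k) * U ^ k` has spectrum in `{1, q}`, then the
powers `A ^ k` and `U ^ k`, `0 < k < d`, are annihilated by every functional that is tracial with
respect to `A` and `U`. -/
theorem trace_pow_eq_zero_of_quadratic {d : ℕ} (hd : 2 ≤ d) {q : ℂ} (hq0 : q ≠ 0)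
    (hq : q ^ 2 ≠ 1) {A A' U : R} (hAA' : A * A' = 1) (hA'A : A' * A = 1) (hA : A ^ d = 1)
    (hU : U ^ d = q • 1)
    (hW : ∀ k, 1 ≤ k → k ≤ d → (A' ^ k * U ^ k - 1) * (A' ^ k * U ^ k - q • 1) = 0)
    (τ : R →ₗ[ℂ] ℂ) (hτA : ∀ x, τ (x * A) = τ (A * x)) (hτU : ∀ x, τ (x * U) = τ (U * x))
    {k : ℕ} (hk : 1 ≤ k) (hkd : k < d) : τ (A ^ k) = 0 ∧ τ (U ^ k) = 0 := by
  set η : ℂ := q - 1 with hηdef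
  set κ : ℂ := q⁻¹ - 1 with hκdef
  have hq1 : q ≠ 1 := by rintro rfl; simp at hq
  have hη : η ≠ 0 := sub_ne_zero.mpr hq1
  have hκ : κ ≠ 0 := sub_ne_zero.mpr (by simpa using hq1)
  have hne : η ≠ κ := by
    intro h
    have : q = q⁻¹ := by simpa [hηdef, hκdef] using h
    apply hq
    rw [sq]; nth_rewrite 2 [this]; exact mul_inv_cancel₀ hq0
  have hηκ : (1 + η) * (1 + κ) = 1 := by simp [hηdef, hκdef, hq0]
  have hA'd : A' ^ d = 1 := by
    have h1 : A' ^ d * A ^ d = 1 := by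
      have hc : Commute A' A := hA'A.trans hAA'.symm
      rw [← hc.mul_pow, hA'A, one_pow]
    rwa [hA, mul_one] at h1
  have hcomm : Commute A' A := hA'A.trans hAA'.symm
  have hpowAA' : ∀ n, A ^ n * A' ^ n = 1 := fun n => by
    rw [← hcomm.symm.mul_pow, hAA', one_pow]
  -- For $W_k=A'^kU^k=1+\eta P_k$ the quadratic equation says precisely that $P_k$ is idempotent.
  obtain ⟨P, hPdef⟩ : ∃ P : ℕ → R, ∀ k, P k = η⁻¹ • (A' ^ k * U ^ k - 1) := ⟨_, fun _ => rfl⟩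
  have hWP : ∀ k, 1 + η • P k = A' ^ k * U ^ k := by
    intro k; simp [hPdef, smul_smul, mul_inv_cancel₀ hη]
  have hPP : ∀ k, 1 ≤ k → k ≤ d → P k * P k = P k := by
    intro k h1 h2
    have h := hW k h1 h2
    rw [← hWP k] at h
    have e : (1 + η • P k - 1) * (1 + η • P k - q • 1) = (η * η) • (P k * P k - P k) := by
      have e1 : 1 + η • P k - q • (1 : R) = η • (P k - 1) := by
        rw [smul_sub, hηdef, sub_smul q 1 (1 : R), one_smul]; abel
      rw [e1, add_sub_cancel_left, smul_mul_smul_comm, mul_sub (P k), mul_one]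
    rw [e] at h
    exact sub_eq_zero.mp ((smul_eq_zero.mp h).resolve_left (mul_ne_zero hη hη))
  -- The cocycle identity $W_{k+1}=(A'W_kA)\,W_1$ is a product of two elements of the form
  -- $1+\eta\cdot$idempotent that is again of this form, so the idempotents are orthogonal and add
  -- up.
  have hstep : ∀ k, 1 ≤ k → k + 1 ≤ d →
      P (k + 1) = P 1 + A' * P k * A ∧ P 1 * (A' * P k * A) = 0 := by
    intro k h1 h2
    have hp' : (A' * P k * A) * (A' * P k * A) = A' * P k * A := by
      calc (A' * P k * A) * (A' * P k * A) = A' * P k * (A * A') * P k * A := by noncomm_ring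
        _ = A' * (P k * P k) * A := by rw [hAA']; noncomm_ring
        _ = _ := by rw [hPP k h1 (by omega)]
    have hmul : 1 + η • P (k + 1) = (1 + η • (A' * P k * A)) * (1 + η • P 1) := by
      have e1 : 1 + η • (A' * P k * A) = A' * (A' ^ k * U ^ k) * A := by
        rw [← hWP k, mul_add, add_mul, mul_one, hA'A, mul_smul_comm, smul_mul_assoc]
      rw [e1, hWP, hWP, pow_one, pow_one]
      calc A' ^ (k + 1) * U ^ (k + 1) = A' * (A' ^ k * U ^ k) * 1 * U := by
            rw [pow_succ', pow_succ]; noncomm_ring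
        _ = _ := by rw [← hAA']; noncomm_ring
    obtain ⟨o1, o2⟩ := orthogonal_of_isIdempotentElem hηκ hne hη hκ (hPP 1 le_rfl (by omega)) hp'
      (hPP (k + 1) (by omega) h2) hmul
    refine ⟨?_, o1⟩
    have : η • P (k + 1) = η • (P 1 + A' * P k * A) := by
      have := hmul
      rw [mul_add, mul_one, add_mul, one_mul, smul_mul_smul_comm, o2, smul_zero, add_zero,
        add_assoc] at this
      rw [add_left_cancel this, smul_add, add_comm]
    exact smul_right_injective R hη this
  have hsum : ∀ k, 1 ≤ k → k ≤ d → P k = ∑ j ∈ Finset.range k, A' ^ j * P 1 * A ^ j := by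
    intro k h1
    induction k, h1 using Nat.le_induction with
    | base => intro _; simp
    | succ k h1 ih =>
      intro h2
      rw [(hstep k h1 h2).1, ih (by omega), Finset.sum_range_succ', Finset.mul_sum, Finset.sum_mul,
        pow_zero, pow_zero, one_mul, mul_one, add_comm]
      congr 1
      refine Finset.sum_congr rfl fun j _ => ?_
      rw [pow_succ' A', pow_succ A]; noncomm_ring
  -- $P_1$ kills the sum of the conjugates with indices $1,\dots,j$ for each $j$; subtracting
  -- consecutive sums isolates one conjugate.
  have horth : ∀ j, 1 ≤ j → j + 1 ≤ d → P 1 * (A' ^ j * P 1 * A ^ j) = 0 := by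
    intro j h1 h2
    have e : ∀ k, 1 ≤ k → k + 1 ≤ d → A' * P k * A = P (k + 1) - P 1 := fun k a b => by
      rw [(hstep k a b).1]; abel
    have hj := (hstep j h1 h2).2
    rcases Nat.eq_or_lt_of_le h1 with h | h
    · subst h; simpa using hj
    · have hj' := (hstep (j - 1) (by omega) (by omega)).2
      rw [e j h1 h2, hsum (j + 1) (by omega) h2, Finset.sum_range_succ] at hj
      rw [e (j - 1) (by omega) (by omega), Nat.sub_add_cancel h1, hsum j h1 (by omega)] at hj'
      rw [add_sub_right_comm, mul_add, hj', zero_add] at hj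
      exact hj
  -- Since $A$ has order $d$, $A^k=A'^{d-k}$, which turns the product into $P_1$ times a conjugate
  -- of $P_1$.
  have hPAP : ∀ k, 1 ≤ k → k < d → P 1 * A ^ k * P 1 = 0 := by
    intro k h1 h2
    have h := horth (d - k) (by omega) (by omega)
    have e : A ^ k = A' ^ (d - k) := by
      calc A ^ k = A ^ k * A' ^ (k + (d - k)) := by
            rw [Nat.add_sub_cancel' h2.le, hA'd, mul_one]
        _ = _ := by rw [pow_add, ← mul_assoc, hpowAA', one_mul]
    calc P 1 * A ^ k * P 1 = P 1 * (A' ^ (d - k) * P 1 * (A ^ (d - k) * A' ^ (d - k))) := by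
          rw [hpowAA', mul_one, e, mul_assoc]
      _ = P 1 * (A' ^ (d - k) * P 1 * A ^ (d - k)) * A' ^ (d - k) := by noncomm_ring
      _ = 0 := by rw [h, zero_mul]
  have hτpow : ∀ j x, τ (x * A ^ j) = τ (A ^ j * x) := by
    intro j
    induction j with
    | zero => intro x; simp
    | succ j ih =>
      intro x
      rw [pow_succ, ← mul_assoc, hτA, ← mul_assoc, ih, mul_assoc]
  have hA'pow : A' = A ^ (d - 1) := by
    calc A' = A' * A ^ (1 + (d - 1)) := by rw [Nat.add_sub_cancel' (by omega), hA, mul_one]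
      _ = _ := by rw [pow_add, pow_one, ← mul_assoc, hA'A, one_mul]
  -- $P_1$ is affine in $A'U$ and $A'=A^{d-1}$, so traciality passes from $A$ and $U$ to $P_1$.
  have hτP : ∀ x, τ (x * P 1) = τ (P 1 * x) := by
    intro x
    simp only [hPdef, pow_one, mul_smul_comm, smul_mul_assoc, map_smul, mul_sub, sub_mul, mul_one,
      one_mul, map_sub]
    congr 2
    rw [← mul_assoc, hτU, ← mul_assoc, hA'pow, hτpow, ← mul_assoc]
  have hτAP : ∀ j, τ (A ^ k * (A' ^ j * P 1 * A ^ j)) = 0 := by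
    intro j
    rw [← mul_assoc, hτpow, ← mul_assoc, ← mul_assoc, ← pow_add, add_comm, pow_add,
      mul_assoc (A ^ k), hpowAA', mul_one, ← hPP 1 le_rfl (by omega), ← mul_assoc, hτP,
      ← mul_assoc, hPAP k hk hkd, map_zero]
  have hAk : τ (A ^ k) = 0 := by
    -- $W_d=U^d=q$, so the conjugates of $P_1$ resolve the identity.
    have hPd : P d = 1 := by
      have : q • (1 : R) - 1 = η • 1 := by rw [hηdef, sub_smul, one_smul]
      rw [hPdef, hA'd, hU, one_mul, this, smul_smul, inv_mul_cancel₀ hη, one_smul]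
    rw [← mul_one (A ^ k), ← hPd, hsum d (by omega) le_rfl, Finset.mul_sum, map_sum]
    exact Finset.sum_eq_zero fun j _ => hτAP j
  refine ⟨hAk, ?_⟩
  have e : U ^ k = A ^ k + η • ∑ j ∈ Finset.range k, A ^ k * (A' ^ j * P 1 * A ^ j) := by
    rw [← Finset.mul_sum, ← hsum k hk hkd.le, ← mul_smul_comm]
    calc U ^ k = A ^ k * (A' ^ k * U ^ k) := by rw [← mul_assoc, hpowAA', one_mul]
      _ = _ := by rw [← hWP k, mul_add, mul_one]
  rw [e, map_add, hAk, map_smul, map_sum, Finset.sum_eq_zero fun j _ => hτAP j]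
  simp

end Ring

-- Powers of ω and the coefficients of the Bell expression

theorem omegaPow_add (d : ℕ) (r s : ℝ) : omegaPow d (r + s) = omegaPow d r * omegaPow d s := by
  simp only [omegaPow, ← Complex.exp_add]
  push_cast
  ring_nf

@[simp] theorem omegaPow_zero (d : ℕ) : omegaPow d 0 = 1 := by simp [omegaPow]

theorem omegaPow_ne_zero (d : ℕ) (r : ℝ) : omegaPow d r ≠ 0 := Complex.exp_ne_zero _

theorem omegaPow_mul_neg (d : ℕ) (r : ℝ) : omegaPow d r * omegaPow d (-r) = 1 := by
  rw [← omegaPow_add, add_neg_cancel, omegaPow_zero]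

theorem conj_omegaPow (d : ℕ) (r : ℝ) : conj (omegaPow d r) = omegaPow d (-r) := by
  simp only [omegaPow, ← Complex.exp_conj, map_mul, map_div₀, Complex.conj_I, Complex.conj_ofReal,
    Complex.conj_ofNat, Complex.conj_natCast]
  push_cast
  ring_nf

theorem norm_omegaPow (d : ℕ) (r : ℝ) : ‖omegaPow d r‖ = 1 := by
  have : omegaPow d r = Complex.exp ((2 * Real.pi / d * r : ℝ) * Complex.I) := by
    simp only [omegaPow]; push_cast; ring_nf
  rw [this, Complex.norm_exp_ofReal_mul_I]

theorem omegaPow_mul_nat (d : ℕ) (r : ℝ) (n : ℕ) : omegaPow d (r * n) = omegaPow d r ^ n := by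
  simp only [omegaPow, ← Complex.exp_nat_mul]
  push_cast
  ring_nf

theorem omegaPow_mul_int (d : ℕ) (r : ℝ) (n : ℤ) : omegaPow d (r * n) = omegaPow d r ^ n := by
  simp only [omegaPow, ← Complex.exp_int_mul]
  push_cast
  ring_nf

theorem omegaPow_self {d : ℕ} (hd : d ≠ 0) : omegaPow d d = 1 := by
  have : (d : ℂ) ≠ 0 := by exact_mod_cast hd
  rw [omegaPow, ← Complex.exp_two_pi_mul_I]
  congr 1
  push_cast
  field_simp

theorem omegaPow_self_mul {d : ℕ} (hd : d ≠ 0) (n : ℤ) : omegaPow d (d * n) = 1 := by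
  rw [omegaPow_mul_int, omegaPow_self hd, one_zpow]

/-- `ω ^ (d r / 2m) = exp (i π r / m)`. -/
theorem omegaPow_half {d : ℕ} (hd : d ≠ 0) (m : ℕ) (r : ℝ) :
    omegaPow d (d * r / (2 * m)) = Complex.exp ((Real.pi / m * r : ℝ) * Complex.I) := by
  have : (d : ℂ) ≠ 0 := by exact_mod_cast hd
  rw [omegaPow]
  congr 1
  push_cast
  field_simp

theorem omegaPow_add_neg {d : ℕ} (hd : d ≠ 0) (m : ℕ) (r : ℝ) :
    omegaPow d (d * r / (2 * m)) + omegaPow d (-(d * r / (2 * m))) =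
      ((2 * Real.cos (Real.pi / m * r) : ℝ) : ℂ) := by
  have h : -(d * r / (2 * m) : ℝ) = d * (-r) / (2 * m) := by ring
  rw [h, omegaPow_half hd, omegaPow_half hd]
  push_cast
  rw [Complex.cos]
  ring_nf

theorem cos_pi_div_two_mul_pos {m : ℕ} (hm : 2 ≤ m) : 0 < Real.cos (Real.pi / (2 * m)) := by
  have h2 : (2 : ℝ) ≤ m := by exact_mod_cast hm
  have hpi := Real.pi_pos
  apply Real.cos_pos_of_mem_Ioo
  constructor
  · have : 0 < Real.pi / (2 * m) := by positivity
    linarith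
  · apply div_lt_div_of_pos_left hpi (by norm_num); linarith

theorem coeffA_mul {m : ℕ} (hm : 2 ≤ m) (d k : ℕ) :
    coeffA m d k * ((2 * Real.cos (Real.pi / (2 * m)) : ℝ) : ℂ) =
      omegaPow d ((2 * (k : ℝ) - d) / (4 * m)) := by
  rw [coeffA, div_mul_cancel₀]
  have := cos_pi_div_two_mul_pos hm
  exact_mod_cast (by positivity : (2 * Real.cos (Real.pi / (2 * m))) ≠ 0)

theorem coeffA_ne_zero {m : ℕ} (hm : 2 ≤ m) (d k : ℕ) : coeffA m d k ≠ 0 := by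
  intro h
  have := coeffA_mul hm d k
  rw [h, zero_mul] at this
  exact omegaPow_ne_zero _ _ this.symm

theorem coeffA_sub (m : ℕ) {d k : ℕ} (hk : k ≤ d) : coeffA m d (d - k) = conj (coeffA m d k) := by
  rw [coeffA, coeffA, map_div₀, Complex.conj_ofReal, conj_omegaPow, Nat.cast_sub hk]
  congr 2
  ring

/-- For $q=\omega^{d/2m}=e^{i\pi/m}$ one has $1+q=q^{1/2}\cdot2\cos(\pi/2m)$, which cancels the
denominator of $a_k$. -/
theorem one_add_mul_coeffA {m d : ℕ} (hm : 2 ≤ m) (hd : d ≠ 0) (k : ℕ) :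
    (1 + omegaPow d (d / (2 * m))) * coeffA m d k = omegaPow d (k / (2 * m)) := by
  have hm0 : (m : ℝ) ≠ 0 := by positivity
  have h := omegaPow_add_neg hd m (1 / 2)
  have e : Real.pi / m * (1 / 2) = Real.pi / (2 * m) := by ring
  rw [e] at h
  have h1 : 1 + omegaPow d (d / (2 * m)) = omegaPow d (d / (4 * m)) *
      ((2 * Real.cos (Real.pi / (2 * m)) : ℝ) : ℂ) := by
    rw [← h, mul_add, ← omegaPow_add, ← omegaPow_add]
    have e1 : (d : ℝ) / (4 * m) + d * (1 / 2) / (2 * m) = d / (2 * m) := by field_simp; ring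
    have e2 : (d : ℝ) / (4 * m) + -(d * (1 / 2) / (2 * m)) = 0 := by field_simp; ring
    rw [e1, e2, omegaPow_zero, add_comm]
  rw [h1, mul_assoc, mul_comm _ (coeffA m d k), coeffA_mul hm, ← omegaPow_add]
  congr 1
  field_simp
  ring

theorem one_add_mul_conj_coeffA {m d : ℕ} (hm : 2 ≤ m) (hd : d ≠ 0) {k : ℕ} (hk : k ≤ d) :
    (1 + omegaPow d (d / (2 * m))) * conj (coeffA m d k) * omegaPow d (k / (2 * m)) =
      omegaPow d (d / (2 * m)) := by
  rw [← coeffA_sub m hk, one_add_mul_coeffA hm hd, ← omegaPow_add, Nat.cast_sub hk]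
  congr 1
  ring

-- From the linear relations to the quadratic ones

section Ring

variable {R : Type*} [Ring R] [Algebra ℂ R]

/-- With $g=x'y$, the identity $uu'=1$ becomes $(b+ag)^2=g$. Since $W=t\,x'u=t(b+ag)$, eliminating
$g$ leaves a quadratic equation for $W$, and the two scalar hypotheses make its roots $1$ and $q$.
-/
theorem quadratic_of_relation {a b q t : ℂ} (h1 : (1 + q) * a = t) (h2 : (1 + q) * b * t = q)
    {x x' y y' u u' : R} (hxx : x * x' = 1) (hx'x : x' * x = 1) (hy'y : y' * y = 1)
    (huu : u * u' = 1) (hu : u = b • x + a • y) (hu' : u' = a • x' + b • y') :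
    (t • (x' * u) - 1) * (t • (x' * u) - q • 1) = 0 := by
  obtain ⟨g, hg⟩ : ∃ g, g = x' * y := ⟨_, rfl⟩
  obtain ⟨h, hh⟩ : ∃ h, h = y' * x := ⟨_, rfl⟩
  have hhg : h * g = 1 := by
    rw [hh, hg, mul_assoc, ← mul_assoc x, hxx, one_mul, hy'y]
  have e1 : x' * u = b • 1 + a • g := by
    rw [hu, mul_add, mul_smul_comm, mul_smul_comm, hx'x, hg]
  have e2 : u' * x = a • 1 + b • h := by
    rw [hu', add_mul, smul_mul_assoc, smul_mul_assoc, hx'x, hh]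
  have e3 : (b • 1 + a • g) * (a • 1 + b • h) = (1 : R) := by
    rw [← e1, ← e2, mul_assoc, ← mul_assoc u, huu, one_mul, hx'x]
  have e4 : (b • 1 + a • g) * (a • g + b • 1) = g := by
    have := congrArg (fun z => z * g) e3
    simpa only [mul_assoc, add_mul, smul_mul_assoc, one_mul, hhg] using this
  rw [e1]
  simp only [mul_add, add_mul, mul_sub, sub_mul, smul_mul_assoc,
    mul_smul_comm, one_mul, mul_one, smul_add, smul_sub, smul_smul] at e4 ⊢
  linear_combination (norm := module) (t ^ 2) • e4 - (t * h1) • g - h2 • (1 : R)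

/-- The quadratic criterion applies to $tU$ with $t=\omega^{1/2m}$, so that $(tU)^d=q$. The inverse
of $U^k$ is $U^{d-k}$, given by the relation with conjugate coefficients $a_{d-k}=a_k^*$. The trace
of $B^k$ follows from those of $A^k$ and $U^k$ because $a_k\neq0$. -/
theorem trace_pow_eq_zero_of_relation {m d : ℕ} (hm : 2 ≤ m) (hd : 2 ≤ d) {A B U : R}
    (hA : A ^ d = 1) (hB : B ^ d = 1) (hU : U ^ d = 1)
    (hrel : ∀ k, 1 ≤ k → k < d →
      U ^ k = conj (coeffA m d k) • A ^ k + coeffA m d k • B ^ k)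
    (τ : R →ₗ[ℂ] ℂ) (hτA : ∀ x, τ (x * A) = τ (A * x)) (hτU : ∀ x, τ (x * U) = τ (U * x))
    {k : ℕ} (hk : 1 ≤ k) (hkd : k < d) : τ (A ^ k) = 0 ∧ τ (B ^ k) = 0 := by
  have hd0 : d ≠ 0 := by omega
  have hm0 : (m : ℝ) ≠ 0 := by positivity
  set q := omegaPow d (d / (2 * m)) with hqdef
  -- $q^2=e^{2\pi i/m}$ and $0<2\pi/m<2\pi$, since $m\ge2$.
  have hq : q ^ 2 ≠ 1 := by
    have h := omegaPow_half hd0 m 2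
    have e : (d : ℝ) * 2 / (2 * m) = d / (2 * m) * (2 : ℕ) := by push_cast; ring
    rw [e, omegaPow_mul_nat] at h
    rw [hqdef, h]
    intro h1
    have h2 := congrArg Complex.re h1
    rw [Complex.exp_ofReal_mul_I_re, Complex.one_re] at h2
    have hpi := Real.pi_pos
    have hm2 : (2 : ℝ) ≤ m := by exact_mod_cast hm
    have h3 : Real.pi / m * 2 < 2 * Real.pi := by
      rw [mul_comm]
      apply mul_lt_mul_of_pos_left _ two_pos
      rw [div_lt_iff₀ (by linarith)]
      nlinarith
    rw [Real.cos_eq_one_iff_of_lt_of_lt (by have : 0 < Real.pi / m * 2 := by positivity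
                                            linarith) h3] at h2
    have : 0 < Real.pi / m * 2 := by positivity
    linarith
  have hinv : ∀ {X : R}, X ^ d = 1 → ∀ j, j ≤ d →
      X ^ j * (X ^ (d - 1)) ^ j = 1 ∧ (X ^ (d - 1)) ^ j * X ^ j = 1 ∧
        (X ^ (d - 1)) ^ j = X ^ (d - j) := by
    intro X hX j hj
    have e1 : X ^ j * (X ^ (d - 1)) ^ j = 1 := by
      rw [← pow_mul, ← pow_add]
      have : j + (d - 1) * j = d * j := by
        obtain ⟨n, rfl⟩ : ∃ n, d = n + 1 := ⟨d - 1, by omega⟩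
        simp; ring
      rw [this, pow_mul, hX, one_pow]
    refine ⟨e1, ?_, ?_⟩
    · rw [← e1, ← pow_mul, ← pow_add, ← pow_add, add_comm]
    · calc (X ^ (d - 1)) ^ j = X ^ (d - j) * X ^ j * (X ^ (d - 1)) ^ j := by
            rw [← pow_add, Nat.sub_add_cancel hj, hX, one_mul]
        _ = _ := by rw [mul_assoc, e1, mul_one]
  set t := omegaPow d (1 / (2 * m)) with ht
  have htk : ∀ j : ℕ, t ^ j = omegaPow d (j / (2 * m)) := fun j => by
    rw [ht, ← omegaPow_mul_nat]; congr 1; ring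
  have key := fun (j : ℕ) (h1 : 1 ≤ j) (h2 : j < d) => trace_pow_eq_zero_of_quadratic hd
    (omegaPow_ne_zero d _) hq (A := A) (A' := A ^ (d - 1)) (U := t • U)
    (by simpa using (hinv hA 1 (by omega)).1) (by simpa using (hinv hA 1 (by omega)).2.1) hA
    (by rw [smul_pow, hU, htk])
    (by
      intro j hj1 hj2
      -- The linear relation stops at $d-1$; at $d$ itself $W_d$ is the scalar $q$.
      rcases Nat.eq_or_lt_of_le hj2 with rfl | hj2
      · rw [smul_pow, hU, htk, (hinv hA _ le_rfl).2.2]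
        simp
      · rw [smul_pow, htk, mul_smul_comm]
        refine quadratic_of_relation (one_add_mul_coeffA hm hd0 j)
          (one_add_mul_conj_coeffA hm hd0 hj2.le) (hinv hA j hj2.le).1 (hinv hA j hj2.le).2.1
          (hinv hB j hj2.le).2.1 (u' := U ^ (d - j)) ?_ (hrel j hj1 hj2) ?_
        · rw [← pow_add, Nat.add_sub_cancel' hj2.le, hU]
        · rw [hrel (d - j) (by omega) (by omega), coeffA_sub m hj2.le, Complex.conj_conj,
            (hinv hA j hj2.le).2.2, (hinv hB j hj2.le).2.2])
    τ hτA (by intro x; rw [mul_smul_comm, smul_mul_assoc, map_smul, map_smul, hτU]) h1 h2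
  obtain ⟨h1, h2⟩ := key k hk hkd
  refine ⟨h1, ?_⟩
  rw [smul_pow, map_smul, smul_eq_mul, htk, mul_eq_zero, hrel k hk hkd, map_add, map_smul, map_smul,
    h1, smul_zero, zero_add, smul_eq_mul, mul_eq_zero] at h2
  exact (h2.resolve_left (omegaPow_ne_zero _ _)).resolve_left (coeffA_ne_zero hm _ _)

end Ring

-- Cyclic modules over a commutant

section Cyclic

variable {H : Type*} [AddCommGroup H] [Module ℂ H] (C : Subalgebra ℂ (Module.End ℂ H)) (ψ : H)

/-- The restriction of an operator that commutes with the algebra `C` to the cyclic `C`-module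
generated by `ψ`. -/
def restrictCyclic (X : Module.End ℂ H) (hX : ∀ c ∈ C, c * X = X * c)
    (hψ : X ψ ∈ Submodule.span C {ψ}) : Module.End C (Submodule.span C {ψ}) :=
  LinearMap.restrict
    ({ toFun := X, map_add' := map_add X,
       map_smul' := fun c v => (DFunLike.congr_fun (hX c c.2) v).symm } : H →ₗ[C] H)
    (by
      intro v hv
      obtain ⟨c, rfl⟩ := Submodule.mem_span_singleton.mp hv
      rw [map_smul]
      exact Submodule.smul_mem _ _ hψ)

@[simp] theorem restrictCyclic_apply (X : Module.End ℂ H) (hX : ∀ c ∈ C, c * X = X * c)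
    (hψ : X ψ ∈ Submodule.span C {ψ}) (v : Submodule.span C {ψ}) :
    (restrictCyclic C ψ X hX hψ v : H) = X v := rfl

theorem restrictCyclic_pow_apply (X : Module.End ℂ H) (hX : ∀ c ∈ C, c * X = X * c)
    (hψ : X ψ ∈ Submodule.span C {ψ}) (k : ℕ) (v : Submodule.span C {ψ}) :
    ((restrictCyclic C ψ X hX hψ ^ k) v : H) = (X ^ k) v := by
  induction k with
  | zero => simp
  | succ k ih => rw [pow_succ', pow_succ', Module.End.mul_apply, restrictCyclic_apply, ih,
      Module.End.mul_apply]

instance : Module C (Submodule.span C {ψ}) := Submodule.module _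

instance : SMul C (Submodule.span C {ψ}) := Submodule.smul _

theorem endCyclic_apply_of_mem (w : Module.End C (Submodule.span C {ψ})) {c : Module.End ℂ H}
    (hc : c ∈ C) {v : Submodule.span C {ψ}} (hv : (v : H) = c ψ) :
    (w v : H) = c (w ⟨ψ, Submodule.mem_span_singleton_self ψ⟩) := by
  have e : v = (⟨c, hc⟩ : C) • ⟨ψ, Submodule.mem_span_singleton_self ψ⟩ := Subtype.ext hv
  rw [e, map_smul]
  rfl

/-- A $C$-linear map is fixed by its value on the generator, which promotes relations on $\psi$ to
identities in the endomorphism ring. -/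
theorem endCyclic_ext {f g : Module.End C (Submodule.span C {ψ})}
    (h : f ⟨ψ, Submodule.mem_span_singleton_self ψ⟩ =
      g ⟨ψ, Submodule.mem_span_singleton_self ψ⟩) : f = g := by
  ext ⟨v, hv⟩
  obtain ⟨c, rfl⟩ := Submodule.mem_span_singleton.mp hv
  have e : (⟨c • ψ, hv⟩ : Submodule.span C {ψ}) =
      c • ⟨ψ, Submodule.mem_span_singleton_self ψ⟩ := rfl
  rw [e, map_smul, map_smul, h]

instance : IsScalarTower ℂ C H := ⟨fun _ _ _ => rfl⟩

instance : SMulCommClass C ℂ (Submodule.span C {ψ}) :=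
  ⟨fun c z v => Subtype.ext (map_smul (c : Module.End ℂ H) z (v : H))⟩

instance : AddCommGroup (Submodule.span C {ψ}) := Submodule.addCommGroup _

instance : Ring (Module.End C (Submodule.span C {ψ})) := Module.End.instRing

instance : Algebra ℂ (Module.End C (Submodule.span C {ψ})) :=
  Module.End.instAlgebra ℂ C (Submodule.span C {ψ})

theorem endCyclic_smul_apply (z : ℂ) (f : Module.End C (Submodule.span C {ψ}))
    (v : Submodule.span C {ψ}) : ((z • f) v : H) = z • (f v : H) := rfl

end Cyclic

-- Tracelessness from relations on a single vector

section Core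

variable {H : Type*} [NormedAddCommGroup H] [InnerProductSpace ℂ H]

/-- `X` is a unitary operator of order `d`. -/
structure IsUnitaryOfOrder (d : ℕ) (X : Module.End ℂ H) : Prop where
  pow_eq_one : X ^ d = 1
  inner_left : ∀ v w, inner ℂ (X v) w = inner ℂ v ((X ^ (d - 1)) w)

theorem IsUnitaryOfOrder.inner_right {d : ℕ} {X : Module.End ℂ H} (h : IsUnitaryOfOrder d X)
    (v w : H) : inner ℂ v (X w) = inner ℂ ((X ^ (d - 1)) v) w := by
  rw [← inner_conj_symm, h.inner_left, inner_conj_symm]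

/-- $R$ and $T$ lie in the commutant of $A,B$ and imitate $U=a_1^*A+a_1B$ and $A$ on $\psi$. This
keeps $A$, $B$, $U$ inside the cyclic module and makes $w\mapsto\langle\psi,F\,w\psi\rangle$ tracial
with respect to $A$ and $U$. -/
theorem inner_pow_eq_zero_of_relation {m d : ℕ} (hm : 2 ≤ m) (hd : 2 ≤ d)
    {A B R T T' F : Module.End ℂ H} {ψ : H} (hA : IsUnitaryOfOrder d A) (hB : IsUnitaryOfOrder d B)
    (hR : IsUnitaryOfOrder d R) (hT : ∀ v w, inner ℂ v (T w) = inner ℂ (T' v) w)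
    (hAR : Commute A R) (hBR : Commute B R) (hAT : Commute A T) (hBT : Commute B T)
    (hAF : Commute A F) (hBF : Commute B F) (hRF : Commute R F) (hTF : Commute T F)
    (hTψ : A ψ = T ψ) (hT'ψ : (A ^ (d - 1)) ψ = T' ψ)
    (hrel : ∀ k, 1 ≤ k → k < d →
      (R ^ k) ψ = conj (coeffA m d k) • (A ^ k) ψ + coeffA m d k • (B ^ k) ψ)
    {k : ℕ} (hk : 1 ≤ k) (hkd : k < d) :
    inner ℂ ψ (F ((A ^ k) ψ)) = 0 ∧ inner ℂ ψ (F ((B ^ k) ψ)) = 0 := by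
  set C : Subalgebra ℂ (Module.End ℂ H) := Subalgebra.centralizer ℂ {A, B} with hC
  have hmem : ∀ {X : Module.End ℂ H}, Commute A X → Commute B X → X ∈ C := by
    intro X h1 h2
    rw [hC, Subalgebra.mem_centralizer_iff]
    rintro g (rfl | rfl)
    exacts [h1, h2]
  have hCA : ∀ c ∈ C, c * A = A * c := fun c hc =>
    ((Subalgebra.mem_centralizer_iff ℂ).mp hc A (by simp)).symm
  have hCB : ∀ c ∈ C, c * B = B * c := fun c hc =>
    ((Subalgebra.mem_centralizer_iff ℂ).mp hc B (by simp)).symm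
  have hspan : ∀ {X : Module.End ℂ H}, X ∈ C → X ψ ∈ Submodule.span C {ψ} := fun {X} hX =>
    Submodule.mem_span_singleton.mpr ⟨⟨X, hX⟩, rfl⟩
  have hRC := hmem hAR hBR
  have hTC := hmem hAT hBT
  have hFC := hmem hAF hBF
  set a := coeffA m d 1 with ha
  have ha0 : a ≠ 0 := coeffA_ne_zero hm d 1
  have hAψ : A ψ ∈ Submodule.span C {ψ} := hTψ ▸ hspan hTC
  have hrel1 : R ψ = conj a • A ψ + a • B ψ := by simpa using hrel 1 le_rfl (by omega)
  have hBψ : B ψ ∈ Submodule.span C {ψ} := by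
    have e : B ψ = (a⁻¹ • (R - conj a • T)) ψ := by
      simp only [LinearMap.smul_apply, LinearMap.sub_apply, ← hTψ, hrel1, add_sub_cancel_left,
        smul_smul, inv_mul_cancel₀ ha0, one_smul]
    rw [e]
    exact hspan (C.smul_mem (C.sub_mem hRC (C.smul_mem hTC _)) _)
  set U : Module.End ℂ H := conj a • A + a • B with hU
  have hUψ : U ψ = R ψ := by simp [hU, hrel1]
  have hCU : ∀ c ∈ C, c * U = U * c := fun c hc => by
    simp only [hU, mul_add, add_mul, mul_smul_comm, smul_mul_assoc, hCA c hc, hCB c hc]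
  have hUψ' : U ψ ∈ Submodule.span C {ψ} := hUψ ▸ hspan hRC
  -- $U$ commutes with $R$, so $U\psi=R\psi$ propagates to all powers.
  have hUR : ∀ j : ℕ, (U ^ j) ψ = (R ^ j) ψ := by
    intro j
    induction j with
    | zero => rfl
    | succ j ih =>
      rw [pow_succ', Module.End.mul_apply, ih, ← Module.End.mul_apply,
        ← hCU _ (C.pow_mem hRC j), Module.End.mul_apply, hUψ, ← Module.End.mul_apply, ← pow_succ]
  -- The relation at $d-1$ has conjugate coefficients and inverse powers, so it reads
  -- $R^*\psi=U^*\psi$.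
  have hadj : ∀ w, inner ℂ ((R ^ (d - 1)) ψ) w = inner ℂ ψ (U w) := by
    intro w
    rw [hrel (d - 1) (by omega) (by omega), coeffA_sub m (by omega), Complex.conj_conj, hU,
      LinearMap.add_apply, LinearMap.smul_apply, LinearMap.smul_apply, inner_add_left,
      inner_add_right, inner_smul_left, inner_smul_left, inner_smul_right, inner_smul_right,
      hA.inner_right, hB.inner_right, Complex.conj_conj]
  set A₁ := restrictCyclic C ψ A hCA hAψ
  set B₁ := restrictCyclic C ψ B hCB hBψ
  set U₁ := restrictCyclic C ψ U hCU hUψ'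
  set ψ₁ : Submodule.span C {ψ} := ⟨ψ, Submodule.mem_span_singleton_self ψ⟩
  let τ : Module.End C (Submodule.span C {ψ}) →ₗ[ℂ] ℂ :=
    { toFun := fun w => inner ℂ ψ (F (w ψ₁))
      map_add' := fun w w' => by
        rw [LinearMap.add_apply, Submodule.coe_add, map_add, inner_add_right]
      map_smul' := fun z w => by
        rw [endCyclic_smul_apply, map_smul, inner_smul_right]; rfl }
  have hτ : ∀ w, τ w = inner ℂ ψ (F (w ψ₁)) := fun _ => rfl
  have hCF : ∀ {X : Module.End ℂ H}, Commute X F → ∀ v, F (X v) = X (F v) := fun h v =>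
    (DFunLike.congr_fun h.eq v).symm
  have hUF : Commute U F := ((hAF.smul_left _).add_left (hBF.smul_left _))
  -- On $\psi$ replace $A$ by $T$, pull $T$ through $w$ and $F$, move it to the left slot, and there
  -- turn $T'\psi$ back into $A^*\psi$.
  have hτA : ∀ w, τ (w * A₁) = τ (A₁ * w) := by
    intro w
    rw [hτ, hτ, Module.End.mul_apply, Module.End.mul_apply, restrictCyclic_apply,
      endCyclic_apply_of_mem C ψ w hTC hTψ, hCF hTF, hT, ← hT'ψ, hCF hAF, hA.inner_right]
  have hτU : ∀ w, τ (w * U₁) = τ (U₁ * w) := by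
    intro w
    rw [hτ, hτ, Module.End.mul_apply, Module.End.mul_apply, restrictCyclic_apply,
      endCyclic_apply_of_mem C ψ w hRC hUψ, hCF hRF, hR.inner_right, hadj, hCF hUF]
  have hpow : ∀ {X : Module.End ℂ H} (hX : ∀ c ∈ C, c * X = X * c)
      (hψ : X ψ ∈ Submodule.span C {ψ}), (X ^ d) ψ = ψ →
      restrictCyclic C ψ X hX hψ ^ d = 1 := by
    intro X hX hψ h
    apply endCyclic_ext
    apply Subtype.ext
    rw [restrictCyclic_pow_apply]
    exact h
  have hA1 : A₁ ^ d = 1 := hpow hCA hAψ (by rw [hA.pow_eq_one]; rfl)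
  have hB1 : B₁ ^ d = 1 := hpow hCB hBψ (by rw [hB.pow_eq_one]; rfl)
  have hU1 : U₁ ^ d = 1 := hpow hCU hUψ' (by rw [hUR, hR.pow_eq_one]; rfl)
  have hrel₁ : ∀ j, 1 ≤ j → j < d →
      U₁ ^ j = conj (coeffA m d j) • A₁ ^ j + coeffA m d j • B₁ ^ j := by
    intro j h1 h2
    apply endCyclic_ext C ψ
    apply Subtype.ext
    rw [LinearMap.add_apply, Submodule.coe_add, endCyclic_smul_apply, endCyclic_smul_apply,
      restrictCyclic_pow_apply, restrictCyclic_pow_apply, restrictCyclic_pow_apply]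
    exact (hUR j).trans (hrel j h1 h2)
  have h := trace_pow_eq_zero_of_relation (R := Module.End C (Submodule.span C {ψ}))
    (A := A₁) (B := B₁) (U := U₁) hm hd hA1 hB1 hU1 hrel₁ τ hτA hτU hk hkd
  rw [hτ, hτ, restrictCyclic_pow_apply, restrictCyclic_pow_apply] at h
  exact h

/-- Two commuting pairs of unitaries of order `d` which are related on `ψ` by the conditions for
maximal violation are traceless, also when correlated with any operator that commutes with them. -/
theorem inner_pow_eq_zero_of_bipartite {m d : ℕ} (hm : 2 ≤ m) (hd : 2 ≤ d)
    {A B X Y F : Module.End ℂ H} {ψ : H} (hA : IsUnitaryOfOrder d A) (hB : IsUnitaryOfOrder d B)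
    (hX : IsUnitaryOfOrder d X) (hY : IsUnitaryOfOrder d Y)
    (hAX : Commute A X) (hAY : Commute A Y) (hBX : Commute B X) (hBY : Commute B Y)
    (hAF : Commute A F) (hBF : Commute B F) (hXF : Commute X F) (hYF : Commute Y F)
    (hrelX : ∀ k, 1 ≤ k → k < d →
      (X ^ k) ψ = conj (coeffA m d k) • (A ^ k) ψ + coeffA m d k • (B ^ k) ψ)
    (hrelB : ∀ k, 1 ≤ k → k < d →
      (B ^ k) ψ = conj (coeffA m d k) • (X ^ k) ψ + coeffA m d k • (Y ^ k) ψ)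
    {k : ℕ} (hk : 1 ≤ k) (hkd : k < d) :
    inner ℂ ψ (F ((A ^ k) ψ)) = 0 ∧ inner ℂ ψ (F ((B ^ k) ψ)) = 0 ∧
      inner ℂ ψ (F ((X ^ k) ψ)) = 0 ∧ inner ℂ ψ (F ((Y ^ k) ψ)) = 0 := by
  have hconj : coeffA m d (d - 1) = conj (coeffA m d 1) := coeffA_sub m (by omega)
  set a := coeffA m d 1 with ha
  have ha0 : a ≠ 0 := coeffA_ne_zero hm d 1
  have ha1 : conj a ≠ 0 := by simpa using ha0
  have hX1 := hrelX 1 le_rfl (by omega)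
  have hB1 := hrelB 1 le_rfl (by omega)
  have hXd := hrelX (d - 1) (by omega) (by omega)
  have hBd := hrelB (d - 1) (by omega) (by omega)
  rw [hconj, Complex.conj_conj] at hXd hBd
  rw [← ha] at hX1 hB1
  simp only [pow_one] at hX1 hB1
  -- The operator $T$ comes from solving the relation for $X$ for $A\psi$ and inserting the relation
  -- for $B$, so that only $X$ and $Y$ remain.
  have h1 := inner_pow_eq_zero_of_relation hm hd (A := A) (B := B) (R := X) (F := F) (ψ := ψ)
    (T := (conj a)⁻¹ • (X - a • (conj a • X + a • Y)))
    (T' := a⁻¹ • (X ^ (d - 1) - conj a • (a • X ^ (d - 1) + conj a • Y ^ (d - 1))))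
    hA hB hX
    (by
      intro v w
      simp only [LinearMap.smul_apply, LinearMap.sub_apply, LinearMap.add_apply, inner_smul_left,
        inner_smul_right, inner_sub_left, inner_sub_right, inner_add_left, inner_add_right,
        hX.inner_right, hY.inner_right, map_inv₀, Complex.conj_conj])
    hAX hBX
    ((hAX.sub_right (((hAX.smul_right _).add_right (hAY.smul_right _)).smul_right _)).smul_right _)
    ((hBX.sub_right (((hBX.smul_right _).add_right (hBY.smul_right _)).smul_right _)).smul_right _)
    hAF hBF hXF
    ((hXF.sub_left (((hXF.smul_left _).add_left (hYF.smul_left _)).smul_left _)).smul_left _)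
    (by
      simp only [LinearMap.smul_apply, LinearMap.sub_apply, LinearMap.add_apply, ← hB1]
      rw [hX1, add_sub_cancel_right, smul_smul, inv_mul_cancel₀ ha1, one_smul])
    (by
      simp only [LinearMap.smul_apply, LinearMap.sub_apply, LinearMap.add_apply, ← hBd]
      rw [hXd, add_sub_cancel_right, smul_smul, inv_mul_cancel₀ ha0, one_smul])
    hrelX hk hkd
  -- The roles of the pairs are exchanged: $B$ is the given combination of $X,Y$, and $X$ acts on
  -- $\psi$ as $a_1^*A+a_1B$.
  have h2 := inner_pow_eq_zero_of_relation hm hd (A := X) (B := Y) (R := B) (F := F) (ψ := ψ)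
    (T := conj a • A + a • B) (T' := a • A ^ (d - 1) + conj a • B ^ (d - 1)) hX hY hB
    (by
      intro v w
      simp only [LinearMap.smul_apply, LinearMap.add_apply, inner_smul_left,
        inner_smul_right, inner_add_left, inner_add_right,
        hA.inner_right, hB.inner_right, Complex.conj_conj])
    hBX.symm hBY.symm ((hAX.symm.smul_right _).add_right (hBX.symm.smul_right _))
    ((hAY.symm.smul_right _).add_right (hBY.symm.smul_right _)) hXF hYF hBF
    ((hAF.smul_left _).add_left (hBF.smul_left _)) hX1 hXd hrelB hk hkd
  exact ⟨h1.1, h1.2, h2.1, h2.2⟩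

end Core

-- Antiperiodic chains of unit vectors

section Chain

variable {H : Type*} [NormedAddCommGroup H] [InnerProductSpace ℝ H]

/-- Picone-type identity behind the optimal bound for antiperiodic chains of vectors. -/
theorem chain_term_identity {c s cj sj cj' sj' : ℝ} {v₀ v w : H}
    (h1 : cj' = cj * c - sj * s) (h2 : sj' = sj * c + cj * s) (hcs : c ^ 2 + s ^ 2 = 1)
    (hv : sj = 0 → v = cj • v₀) (hw : sj' = 0 → w = cj' • v₀) :
    c * (‖v‖ ^ 2 + ‖w‖ ^ 2) / 2 - inner ℝ v w =
      sj * sj' * ‖sj'⁻¹ • (w - cj' • v₀) - sj⁻¹ • (v - cj • v₀)‖ ^ 2 / 2 +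
      ((s * (cj' / sj') * ‖w - cj' • v₀‖ ^ 2 / 2 - s * sj' * inner ℝ (w - cj' • v₀) v₀ -
          s * sj' * cj' * ‖v₀‖ ^ 2 / 2) -
        (s * (cj / sj) * ‖v - cj • v₀‖ ^ 2 / 2 - s * sj * inner ℝ (v - cj • v₀) v₀ -
          s * sj * cj * ‖v₀‖ ^ 2 / 2)) := by
  obtain ⟨x, hx⟩ : ∃ x, x = v - cj • v₀ := ⟨_, rfl⟩
  obtain ⟨y, hy⟩ : ∃ y, y = w - cj' • v₀ := ⟨_, rfl⟩
  have hv' : v = x + cj • v₀ := by rw [hx]; abel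
  have hw' : w = y + cj' • v₀ := by rw [hy]; abel
  rw [← hx, ← hy]
  -- Where a sine vanishes its inverse is $0$ by convention; the deviation from $c_jv_0$ vanishes
  -- there too, so no term is lost at the ends of the chain.
  have hx0 : sj = 0 → x = 0 := fun h => by rw [hx, hv h, sub_self]
  have hy0 : sj' = 0 → y = 0 := fun h => by rw [hy, hw h, sub_self]
  have e1 : cj = cj' * c + sj' * s := by rw [h1, h2]; linear_combination (-cj) * hcs
  have e2 : sj = sj' * c - cj' * s := by rw [h1, h2]; linear_combination (-sj) * hcs
  rw [hv', hw']
  simp only [norm_add_sq_real, norm_sub_sq_real, norm_smul, inner_add_left, inner_add_right,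
    real_inner_smul_left, real_inner_smul_right, real_inner_self_eq_norm_sq, mul_pow,
    Real.norm_eq_abs, sq_abs, real_inner_comm y v₀, real_inner_comm x y]
  have g1 : sj * sj' * (sj'⁻¹ ^ 2 * ‖y‖ ^ 2) = (c - s * (cj' / sj')) * ‖y‖ ^ 2 := by
    by_cases h : sj' = 0
    · simp [hy0 h]
    · rw [e2]; field_simp
  have g2 : sj * sj' * (sj⁻¹ ^ 2 * ‖x‖ ^ 2) = (c + s * (cj / sj)) * ‖x‖ ^ 2 := by
    by_cases h : sj = 0
    · simp [hx0 h]
    · rw [h2]; field_simp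
  have g3 : sj * sj' * (sj'⁻¹ * (sj⁻¹ * inner ℝ x y)) = inner ℝ x y := by
    by_cases h : sj = 0
    · simp [hx0 h]
    · by_cases h' : sj' = 0
      · simp [hy0 h']
      · field_simp
  linear_combination -g1 / 2 - g2 / 2 + g3 - h1 * inner ℝ x v₀ - e1 * inner ℝ y v₀ -
    ‖v₀‖ ^ 2 / 2 * (cj * h1 + cj' * e1)

/-- Extremal chains are $v_j=\cos(j\pi/m)\,v_0+\sin(j\pi/m)\,z$. For them the quotient
$(v_j-\cos(j\pi/m)v_0)/\sin(j\pi/m)$ is constant at interior $j$, and the squares measure how far it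
is from being constant. -/
theorem chain_sum_identity {m : ℕ} (hm : 2 ≤ m) {v : ℕ → H} (hv : ∀ j ≤ m, ‖v j‖ = 1)
    (hvm : v m = -v 0) :
    m * Real.cos (Real.pi / m) - ∑ j ∈ Finset.range m, inner ℝ (v j) (v (j + 1)) =
      ∑ j ∈ Finset.range m, Real.sin (j * (Real.pi / m)) * Real.sin ((j + 1 : ℕ) * (Real.pi / m)) *
        ‖(Real.sin ((j + 1 : ℕ) * (Real.pi / m)))⁻¹ •
            (v (j + 1) - Real.cos ((j + 1 : ℕ) * (Real.pi / m)) • v 0) -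
          (Real.sin (j * (Real.pi / m)))⁻¹ •
            (v j - Real.cos (j * (Real.pi / m)) • v 0)‖ ^ 2 / 2 := by
  have hm0 : (m : ℝ) ≠ 0 := by positivity
  set γ := Real.pi / m with hγ
  have hmγ : m * γ = Real.pi := by rw [hγ]; field_simp
  have hγ0 : 0 < γ := by have := Real.pi_pos; positivity
  -- The telescoping boundary term; it vanishes at $j=0$ and $j=m$ because the sines do.
  let W : ℕ → ℝ := fun j =>
    Real.sin γ * (Real.cos (j * γ) / Real.sin (j * γ)) * ‖v j - Real.cos (j * γ) • v 0‖ ^ 2 / 2 -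
      Real.sin γ * Real.sin (j * γ) * inner ℝ (v j - Real.cos (j * γ) • v 0) (v 0) -
      Real.sin γ * Real.sin (j * γ) * Real.cos (j * γ) * ‖v 0‖ ^ 2 / 2
  have hvan : ∀ j ≤ m, Real.sin (j * γ) = 0 → v j = Real.cos (j * γ) • v 0 := by
    intro j hj h
    rcases Nat.eq_zero_or_pos j with rfl | h0
    · simp
    · rcases Nat.eq_or_lt_of_le hj with rfl | hlt
      · rw [hmγ, Real.cos_pi, hvm, neg_one_smul]
      · have h1 : (0 : ℝ) < j := by exact_mod_cast h0
        have h2 : (j : ℝ) * γ < Real.pi := by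
          rw [← hmγ]; exact mul_lt_mul_of_pos_right (by exact_mod_cast hlt) hγ0
        exact absurd h (Real.sin_pos_of_pos_of_lt_pi (by positivity) h2).ne'
  have hW : ∑ j ∈ Finset.range m, (W (j + 1) - W j) = 0 := by
    rw [Finset.sum_range_sub]
    simp [W, hmγ]
  have hterm : ∀ j ∈ Finset.range m, Real.cos γ - inner ℝ (v j) (v (j + 1)) =
      Real.sin (j * γ) * Real.sin ((j + 1 : ℕ) * γ) *
        ‖(Real.sin ((j + 1 : ℕ) * γ))⁻¹ • (v (j + 1) - Real.cos ((j + 1 : ℕ) * γ) • v 0) -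
          (Real.sin (j * γ))⁻¹ • (v j - Real.cos (j * γ) • v 0)‖ ^ 2 / 2 +
        (W (j + 1) - W j) := by
    intro j hj
    have hj := Finset.mem_range.mp hj
    have e : ((j + 1 : ℕ) : ℝ) * γ = j * γ + γ := by push_cast; ring
    rw [← chain_term_identity (c := Real.cos γ) (by rw [e, Real.cos_add]) (by rw [e, Real.sin_add])
      (Real.cos_sq_add_sin_sq γ) (hvan j hj.le) (hvan (j + 1) hj),
      hv j hj.le, hv (j + 1) hj]
    ring
  have hsum := Finset.sum_congr rfl hterm
  rw [Finset.sum_add_distrib, hW, add_zero, Finset.sum_sub_distrib] at hsum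
  rw [← hsum]
  simp

theorem chain_term_nonneg {m : ℕ} (hm : 2 ≤ m) {j : ℕ} (hj : j ≤ m) :
    0 ≤ Real.sin (j * (Real.pi / m)) := by
  have hm0 : (0 : ℝ) < m := by positivity
  have hpi := Real.pi_pos
  apply Real.sin_nonneg_of_nonneg_of_le_pi (by positivity)
  rw [← mul_div_assoc, div_le_iff₀ hm0, mul_comm]
  exact mul_le_mul_of_nonneg_left (by exact_mod_cast hj) hpi.le

theorem sum_norm_add_sq_chain {m : ℕ} (hm : 2 ≤ m) {v : ℕ → H} (hv : ∀ j ≤ m, ‖v j‖ = 1) :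
    m * (2 * Real.cos (Real.pi / (2 * m))) ^ 2 -
      ∑ j ∈ Finset.range m, ‖v j + v (j + 1)‖ ^ 2 =
    2 * (m * Real.cos (Real.pi / m) - ∑ j ∈ Finset.range m, inner ℝ (v j) (v (j + 1))) := by
  have e : Real.pi / m = 2 * (Real.pi / (2 * m)) := by
    have hm0 : (m : ℝ) ≠ 0 := by positivity
    field_simp
  have h : ∀ j ∈ Finset.range m, ‖v j + v (j + 1)‖ ^ 2 = 2 + 2 * inner ℝ (v j) (v (j + 1)) := by
    intro j hj
    have hj := Finset.mem_range.mp hj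
    rw [norm_add_sq_real, hv j hj.le, hv (j + 1) hj]
    ring
  rw [Finset.sum_congr rfl h, e, Real.cos_two_mul, Finset.sum_add_distrib, ← Finset.mul_sum]
  simp
  ring

/-- For an antiperiodic chain of `m` unit vectors, neighbours cannot all be too close. -/
theorem sum_norm_add_sq_chain_le {m : ℕ} (hm : 2 ≤ m) {v : ℕ → H} (hv : ∀ j ≤ m, ‖v j‖ = 1)
    (hvm : v m = -v 0) :
    ∑ j ∈ Finset.range m, ‖v j + v (j + 1)‖ ^ 2 ≤
      m * (2 * Real.cos (Real.pi / (2 * m))) ^ 2 := by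
  rw [← sub_nonneg, sum_norm_add_sq_chain hm hv, chain_sum_identity hm hv hvm]
  refine mul_nonneg zero_le_two (Finset.sum_nonneg fun j hj => ?_)
  have hj := Finset.mem_range.mp hj
  have := chain_term_nonneg hm hj.le
  have := chain_term_nonneg hm (j := j + 1) hj
  positivity

/-- In the case of equality the chain satisfies a three-term recurrence. -/
theorem chain_recurrence {m : ℕ} (hm : 2 ≤ m) {v : ℕ → H} (hv : ∀ j ≤ m, ‖v j‖ = 1)
    (hvm : v m = -v 0)
    (h : m * (2 * Real.cos (Real.pi / (2 * m))) ^ 2 ≤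
      ∑ j ∈ Finset.range m, ‖v j + v (j + 1)‖ ^ 2)
    {j : ℕ} (hj : j + 2 ≤ m) :
    v j + v (j + 2) = (2 * Real.cos (Real.pi / m)) • v (j + 1) := by
  have hnn : ∀ j ∈ Finset.range m, 0 ≤ Real.sin (j * (Real.pi / m)) *
      Real.sin ((j + 1 : ℕ) * (Real.pi / m)) *
        ‖(Real.sin ((j + 1 : ℕ) * (Real.pi / m)))⁻¹ •
            (v (j + 1) - Real.cos ((j + 1 : ℕ) * (Real.pi / m)) • v 0) -
          (Real.sin (j * (Real.pi / m)))⁻¹ •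
            (v j - Real.cos (j * (Real.pi / m)) • v 0)‖ ^ 2 / 2 := by
    intro j hj
    have hj := Finset.mem_range.mp hj
    have := chain_term_nonneg hm hj.le
    have := chain_term_nonneg hm (j := j + 1) hj
    positivity
  have h0 := chain_sum_identity hm hv hvm
  have h1 : ∑ j ∈ Finset.range m, Real.sin (j * (Real.pi / m)) *
      Real.sin ((j + 1 : ℕ) * (Real.pi / m)) *
        ‖(Real.sin ((j + 1 : ℕ) * (Real.pi / m)))⁻¹ •
            (v (j + 1) - Real.cos ((j + 1 : ℕ) * (Real.pi / m)) • v 0) -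
          (Real.sin (j * (Real.pi / m)))⁻¹ •
            (v j - Real.cos (j * (Real.pi / m)) • v 0)‖ ^ 2 / 2 = 0 := by
    apply le_antisymm _ (Finset.sum_nonneg hnn)
    rw [← h0]
    have := sum_norm_add_sq_chain hm hv
    linarith
  have h2 := (Finset.sum_eq_zero_iff_of_nonneg hnn).mp h1
  clear hnn h0 h1
  have hm0 : (0 : ℝ) < m := by positivity
  have hpi := Real.pi_pos
  set γ := Real.pi / m with hγ
  have hmγ : m * γ = Real.pi := by rw [hγ]; field_simp
  have hγ0 : 0 < γ := by positivity
  have hpos : ∀ j, 1 ≤ j → j < m → 0 < Real.sin (j * γ) := by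
    intro j h1 h2
    have h1 : (0 : ℝ) < j := by exact_mod_cast h1
    apply Real.sin_pos_of_pos_of_lt_pi (by positivity)
    rw [← hmγ]; exact mul_lt_mul_of_pos_right (by exact_mod_cast h2) hγ0
  -- All squares vanish, so the quotient has the same value $z$ at every interior index. The chain
  -- then lies in the span of $v_0$ and $z$, and the recurrence is an addition formula.
  set z := (Real.sin ((1 : ℕ) * γ))⁻¹ • (v 1 - Real.cos ((1 : ℕ) * γ) • v 0) with hz
  have hzj : ∀ j, 1 ≤ j → j < m →
      (Real.sin (j * γ))⁻¹ • (v j - Real.cos (j * γ) • v 0) = z := by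
    intro j hj
    induction j, hj using Nat.le_induction with
    | base => intro _; rfl
    | succ j hj ih =>
      intro hjm
      have h3 := h2 j (Finset.mem_range.mpr (by omega))
      have p1 := hpos j hj (by omega)
      have p2 := hpos (j + 1) (by omega) hjm
      rw [div_eq_zero_iff, mul_eq_zero, or_iff_left two_ne_zero,
        or_iff_right (mul_pos p1 p2).ne', sq_eq_zero_iff, norm_eq_zero, sub_eq_zero] at h3
      rw [h3, ih (by omega)]
  have hform : ∀ j ≤ m, v j = Real.cos (j * γ) • v 0 + Real.sin (j * γ) • z := by
    intro j hj
    rcases Nat.eq_zero_or_pos j with rfl | h0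
    · simp
    · rcases Nat.eq_or_lt_of_le hj with rfl | hlt
      · rw [hmγ, Real.cos_pi, hvm, neg_one_smul, Real.sin_pi, zero_smul, add_zero]
      · rw [← hzj j h0 hlt, smul_smul, mul_inv_cancel₀ (hpos j h0 hlt).ne', one_smul]
        abel
  rw [hform j (by omega), hform (j + 2) hj, hform (j + 1) (by omega)]
  have a1 : (j : ℝ) * γ = (j + 1 : ℕ) * γ - γ := by push_cast; ring
  have a2 : ((j + 2 : ℕ) : ℝ) * γ = (j + 1 : ℕ) * γ + γ := by push_cast; ring
  rw [a1, a2, Real.cos_sub, Real.sin_sub, Real.cos_add, Real.sin_add]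
  module

theorem sum_norm_add_sq_chain_le_complex {G : Type*} [NormedAddCommGroup G]
    [InnerProductSpace ℂ G] {m : ℕ} (hm : 2 ≤ m) {v : ℕ → G} (hv : ∀ j ≤ m, ‖v j‖ = 1)
    (hvm : v m = -v 0) :
    ∑ j ∈ Finset.range m, ‖v j + v (j + 1)‖ ^ 2 ≤
      m * (2 * Real.cos (Real.pi / (2 * m))) ^ 2 :=
  letI := InnerProductSpace.rclikeToReal ℂ G
  sum_norm_add_sq_chain_le hm hv hvm

theorem chain_recurrence_complex {G : Type*} [NormedAddCommGroup G]
    [InnerProductSpace ℂ G] {m : ℕ} (hm : 2 ≤ m) {v : ℕ → G} (hv : ∀ j ≤ m, ‖v j‖ = 1)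
    (hvm : v m = -v 0)
    (h : m * (2 * Real.cos (Real.pi / (2 * m))) ^ 2 ≤
      ∑ j ∈ Finset.range m, ‖v j + v (j + 1)‖ ^ 2)
    {j : ℕ} (hj : j + 2 ≤ m) :
    v j + v (j + 2) = ((2 * Real.cos (Real.pi / m) : ℝ) : ℂ) • v (j + 1) :=
  letI := InnerProductSpace.rclikeToReal ℂ G
  chain_recurrence hm hv hvm h hj

end Chain

-- Spectral calculus of the measurements

section Projective

variable {n ι : Type*} [Fintype n] [DecidableEq n] [Fintype ι] [DecidableEq ι]

open Matrix ComplexOrder in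
-- Compressing $\sum_aP_a=1$ by $P_c$ and taking traces shows that $\sum_{a\ne
-- c}\operatorname{tr}\big((P_aP_c)^*P_aP_c\big)=0$, a sum of nonnegative terms.
theorem projective_mul_eq_zero {P : ι → Matrix n n ℂ} (hH : ∀ b, (P b).IsHermitian)
    (hP : ∀ b, P b * P b = P b) (hsum : ∑ b, P b = 1) {b c : ι} (hbc : b ≠ c) :
    P b * P c = 0 := by
  have h1 : ∑ a ∈ Finset.univ.erase c, (P c * P a * P c).trace = 0 := by
    have h := congrArg (fun X => (P c * X * P c).trace) hsum
    simp only [Finset.mul_sum, Finset.sum_mul, Matrix.trace_sum, mul_one, hP] at h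
    have h' := Finset.add_sum_erase Finset.univ (fun a => (P c * P a * P c).trace)
      (Finset.mem_univ c)
    rw [h] at h'
    simpa only [hP, add_eq_left] using h'
  have e : ∀ a, P c * P a * P c = (P a * P c)ᴴ * (P a * P c) := by
    intro a
    rw [conjTranspose_mul, (hH a).eq, (hH c).eq, mul_assoc, mul_assoc, ← mul_assoc (P a) (P a), hP]
  have h2 : ∀ a ∈ Finset.univ.erase c, 0 ≤ (P c * P a * P c).trace := by
    intro a _
    rw [e]
    exact (posSemidef_conjTranspose_mul_self _).trace_nonneg
  have h3 := (Finset.sum_eq_zero_iff_of_nonneg h2).mp h1 b (by simp [hbc])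
  rw [e] at h3
  exact trace_conjTranspose_mul_self_eq_zero_iff.mp h3

end Projective

namespace Realization

variable {N m d : ℕ} (S : Realization.{u} N m d)

theorem Q_mul_Q (i : Fin N) (x : Fin m) (b c : Fin d) :
    S.Q i x b * S.Q i x c = if b = c then S.Q i x b else 0 := by
  split_ifs with h
  · rw [← h, S.idempotent_Q]
  · exact projective_mul_eq_zero (S.isHermitian_Q i x) (S.idempotent_Q i x) (S.sum_Q i x) h

/-- The normal matrix with eigenvalues `c b` on the projections `Q i x b`. -/
def spec (i : Fin N) (x : Fin m) (c : Fin d → ℂ) : Matrix (Fin (S.dim i)) (Fin (S.dim i)) ℂ :=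
  ∑ b, c b • S.Q i x b

theorem spec_mul (i : Fin N) (x : Fin m) (c c' : Fin d → ℂ) :
    S.spec i x c * S.spec i x c' = S.spec i x (c * c') := by
  simp only [spec, Finset.sum_mul, Finset.mul_sum, smul_mul_smul_comm, Q_mul_Q, smul_ite,
    smul_zero, Pi.mul_apply]
  refine Finset.sum_congr rfl fun b _ => ?_
  simp

theorem spec_one (i : Fin N) (x : Fin m) : S.spec i x 1 = 1 := by
  simp [spec, S.sum_Q]

theorem spec_pow (i : Fin N) (x : Fin m) (c : Fin d → ℂ) (k : ℕ) :
    S.spec i x c ^ k = S.spec i x (c ^ k) := by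
  induction k with
  | zero => rw [pow_zero, pow_zero, spec_one]
  | succ k ih => rw [pow_succ, ih, spec_mul, pow_succ]

theorem spec_zpow (i : Fin N) (x : Fin m) {c : Fin d → ℂ} (hc : ∀ b, c b ≠ 0) (k : ℤ) :
    S.spec i x c ^ k = S.spec i x (c ^ k) := by
  obtain ⟨k, rfl | rfl⟩ := k.eq_nat_or_neg
  · rw [zpow_natCast, zpow_natCast, spec_pow]
  · rw [Matrix.zpow_neg_natCast, zpow_neg, zpow_natCast, spec_pow]
    apply Matrix.inv_eq_left_inv
    rw [spec_mul, ← spec_one S i x]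
    congr 1
    ext b
    simp [hc b]

theorem spec_conjTranspose (i : Fin N) (x : Fin m) (c : Fin d → ℂ) :
    (S.spec i x c).conjTranspose = S.spec i x (fun b => conj (c b)) := by
  simp only [spec, Matrix.conjTranspose_sum, Matrix.conjTranspose_smul, (S.isHermitian_Q _ _ _).eq]
  rfl

/-- The eigenvalue of `A_{i,y}` for the outcome `b`, with the convention `A_{i,y+m} = ω A_{i,y}`. -/
def eigenvalue (m d y : ℕ) (b : Fin d) : ℂ := omegaPow d ((y / m : ℕ) + (b : ℕ))

theorem eigenvalue_ne_zero (m d y : ℕ) (b : Fin d) : eigenvalue m d y b ≠ 0 :=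
  omegaPow_ne_zero _ _

theorem eigenvalue_pow_order (m : ℕ) {d : ℕ} (hd : d ≠ 0) (y : ℕ) (b : Fin d) :
    eigenvalue m d y b ^ d = 1 := by
  rw [eigenvalue, ← omegaPow_mul_nat, mul_comm]
  exact_mod_cast omegaPow_self_mul hd ((y / m + b : ℕ) : ℤ)

theorem conj_eigenvalue (m d y : ℕ) (b : Fin d) :
    conj (eigenvalue m d y b) = (eigenvalue m d y b)⁻¹ := by
  rw [Complex.inv_def, Complex.normSq_eq_norm_sq, eigenvalue, norm_omegaPow]
  simp

theorem extObservable_eq (hm : 0 < m) (i : Fin N) (y : ℕ) :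
    S.extObservable i y = S.spec i ⟨y % m, Nat.mod_lt y hm⟩ (eigenvalue m d y) := by
  simp only [extObservable, hm, dite_true, observable, spec, Finset.smul_sum, smul_smul,
    eigenvalue, omegaPow_add]

theorem extObservable_zpow (hm : 0 < m) (i : Fin N) (y : ℕ) (k : ℤ) :
    S.extObservable i y ^ k = S.spec i ⟨y % m, Nat.mod_lt y hm⟩ (eigenvalue m d y ^ k) := by
  rw [extObservable_eq S hm, spec_zpow S _ _ (eigenvalue_ne_zero m d y)]

/-- The local operators `A_{i,y i} ^ e i` of all parties. -/
def settingOp (y : Fin N → ℕ) (e : Fin N → ℤ) (i : Fin N) :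
    Matrix (Fin (S.dim i)) (Fin (S.dim i)) ℂ :=
  S.extObservable i (y i) ^ e i

theorem settingOp_mul (hm : 0 < m) (y : Fin N → ℕ) (e e' : Fin N → ℤ) :
    S.settingOp y e * S.settingOp y e' = S.settingOp y (e + e') := by
  funext i
  simp only [Pi.mul_apply, settingOp, extObservable_zpow S hm, spec_mul, Pi.add_apply]
  congr 1
  ext b
  simp [zpow_add₀ (eigenvalue_ne_zero m d (y i) b)]

theorem settingOp_zero (y : Fin N → ℕ) : S.settingOp y 0 = 1 := by
  funext i
  simp [settingOp]

theorem settingOp_pow (hm : 0 < m) (y : Fin N → ℕ) (e : Fin N → ℤ) (k : ℕ) :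
    S.settingOp y e ^ k = S.settingOp y (k • e) := by
  induction k with
  | zero => rw [pow_zero, zero_smul, settingOp_zero]
  | succ k ih => rw [pow_succ, ih, settingOp_mul S hm, succ_nsmul]

theorem settingOp_order (hm : 0 < m) (hd : d ≠ 0) (y : Fin N → ℕ) (e : Fin N → ℤ) :
    S.settingOp y (d • e) = 1 := by
  funext i
  rw [settingOp, extObservable_zpow S hm, Pi.one_apply, ← S.spec_one i ⟨y i % m, Nat.mod_lt _ hm⟩]
  congr 1
  ext b
  simp [zpow_mul, eigenvalue_pow_order m hd]

theorem settingOp_conjTranspose (hm : 0 < m) (y : Fin N → ℕ) (e : Fin N → ℤ) :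
    (fun i => (S.settingOp y e i).conjTranspose) = S.settingOp y (-e) := by
  funext i
  rw [settingOp, settingOp, extObservable_zpow S hm, extObservable_zpow S hm, spec_conjTranspose]
  congr 1
  ext b
  simp [conj_eigenvalue]

theorem settingOp_commute (hm : 0 < m) {y y' : Fin N → ℕ} {e e' : Fin N → ℤ}
    (h : ∀ i, e i = 0 ∨ e' i = 0 ∨ y i = y' i) :
    Commute (S.settingOp y e) (S.settingOp y' e') := by
  funext i
  simp only [Pi.mul_apply, settingOp]
  rcases h i with h | h | h
  · simp [h]
  · simp [h]
  · rw [h]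
    simp only [extObservable_zpow S hm, spec_mul, mul_comm]

theorem settingOp_congr {y y' : Fin N → ℕ} {e e' : Fin N → ℤ}
    (h : ∀ i, e i = e' i ∧ (e i ≠ 0 → y i = y' i)) : S.settingOp y e = S.settingOp y' e' := by
  funext i
  obtain ⟨h1, h2⟩ := h i
  by_cases h0 : e i = 0
  · simp [settingOp, ← h1, h0]
  · rw [settingOp, settingOp, h2 h0, h1]

-- Local operators on the global Hilbert space

/-- The Hilbert space of the parties and the eavesdropper. -/
abbrev Space : Type u := PiLp 2 (fun _ : (∀ i, Fin (S.dim i)) => S.Eve)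

theorem applyParties_apply (M : ∀ i, Matrix (Fin (S.dim i)) (Fin (S.dim i)) ℂ) (v : S.Space)
    (j : ∀ i, Fin (S.dim i)) :
    S.applyParties M v j = ∑ l, (∏ i, M i (j i) (l i)) • v l := rfl

theorem applyParties_mul (M M' : ∀ i, Matrix (Fin (S.dim i)) (Fin (S.dim i)) ℂ) (v : S.Space) :
    S.applyParties (M * M') v = S.applyParties M (S.applyParties M' v) := by
  ext j
  simp only [applyParties_apply, Finset.smul_sum, smul_smul, Pi.mul_apply, Matrix.mul_apply]
  rw [Finset.sum_comm]
  refine Finset.sum_congr rfl fun l _ => ?_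
  rw [← Finset.sum_smul, Finset.prod_univ_sum, Fintype.piFinset_univ]
  simp only [Finset.prod_mul_distrib]

theorem applyParties_one (v : S.Space) : S.applyParties 1 v = v := by
  ext j
  rw [applyParties_apply, Finset.sum_eq_single j]
  · simp
  · intro l _ hl
    obtain ⟨i, hi⟩ := Function.ne_iff.mp hl
    rw [Finset.prod_eq_zero (Finset.mem_univ i), zero_smul]
    simp [Matrix.one_apply_ne (Ne.symm hi)]
  · simp

/-- The representation of tensor products of local operators on the global Hilbert space. -/
def op : (∀ i, Matrix (Fin (S.dim i)) (Fin (S.dim i)) ℂ) →* Module.End ℂ S.Space where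
  toFun M :=
    { toFun := S.applyParties M
      map_add' := fun v w => by
        ext j
        simp [applyParties_apply, Finset.sum_add_distrib]
      map_smul' := fun c v => by
        ext j
        simp only [applyParties_apply, PiLp.smul_apply, Finset.smul_sum, RingHom.id_apply]
        exact Finset.sum_congr rfl fun l _ => smul_comm _ _ _ }
  map_one' := by ext v : 1; exact S.applyParties_one v
  map_mul' M M' := by ext v : 1; exact S.applyParties_mul M M' v

theorem op_apply (M : ∀ i, Matrix (Fin (S.dim i)) (Fin (S.dim i)) ℂ) (v : S.Space) :
    S.op M v = S.applyParties M v := rfl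

theorem inner_op_left (M : ∀ i, Matrix (Fin (S.dim i)) (Fin (S.dim i)) ℂ) (v w : S.Space) :
    inner ℂ (S.op M v) w = inner ℂ v (S.op (fun i => (M i).conjTranspose) w) := by
  simp only [PiLp.inner_apply, op_apply, applyParties_apply, sum_inner, inner_sum, inner_smul_left,
    inner_smul_right]
  rw [Finset.sum_comm]
  refine Finset.sum_congr rfl fun l _ => Finset.sum_congr rfl fun j _ => ?_
  simp [map_prod]

theorem op_update_add (M : ∀ i, Matrix (Fin (S.dim i)) (Fin (S.dim i)) ℂ) (i : Fin N) (a b : ℂ)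
    (X Y : Matrix (Fin (S.dim i)) (Fin (S.dim i)) ℂ) :
    S.op (Function.update M i (a • X + b • Y)) =
      a • S.op (Function.update M i X) + b • S.op (Function.update M i Y) := by
  have key : ∀ (Z : Matrix (Fin (S.dim i)) (Fin (S.dim i)) ℂ) (j l : ∀ i, Fin (S.dim i)),
      ∏ k, Function.update M i Z k (j k) (l k) =
        Z (j i) (l i) * ∏ k ∈ Finset.univ.erase i, M k (j k) (l k) := by
    intro Z j l
    rw [← Finset.mul_prod_erase _ _ (Finset.mem_univ i), Function.update_self]
    congr 1
    refine Finset.prod_congr rfl fun k hk => ?_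
    rw [Function.update_of_ne (Finset.ne_of_mem_erase hk)]
  ext v j
  simp only [LinearMap.add_apply, LinearMap.smul_apply, PiLp.add_apply, PiLp.smul_apply, op_apply,
    applyParties_apply, key, Finset.smul_sum, ← Finset.sum_add_distrib]
  refine Finset.sum_congr rfl fun l _ => ?_
  simp only [Matrix.add_apply, Matrix.smul_apply, smul_eq_mul]
  module

/-- The representation of the operators of the eavesdropper on the global Hilbert space. -/
def eveOp (E : S.Eve →L[ℂ] S.Eve) : Module.End ℂ S.Space where
  toFun := S.applyEve E
  map_add' v w := by ext j; simp [applyEve]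
  map_smul' c v := by ext j; simp [applyEve]

theorem op_commute_eveOp (M : ∀ i, Matrix (Fin (S.dim i)) (Fin (S.dim i)) ℂ)
    (E : S.Eve →L[ℂ] S.Eve) : Commute (S.op M) (S.eveOp E) := by
  ext v j
  change ∑ l, _ • E (v l) = E (∑ l, _ • v l)
  rw [map_sum]
  simp only [map_smul]

theorem op_settingOp_pow (hm : 0 < m) (y : Fin N → ℕ) (e : Fin N → ℤ) (k : ℕ) :
    S.op (S.settingOp y e) ^ k = S.op (S.settingOp y (k • e)) := by
  rw [← map_pow, settingOp_pow S hm]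

theorem isUnitaryOfOrder_op_settingOp (hm : 0 < m) (hd : d ≠ 0) (y : Fin N → ℕ)
    (e : Fin N → ℤ) : IsUnitaryOfOrder d (S.op (S.settingOp y e)) where
  pow_eq_one := by rw [op_settingOp_pow S hm, settingOp_order S hm hd, map_one]
  inner_left v w := by
    rw [inner_op_left, settingOp_conjTranspose S hm, op_settingOp_pow S hm]
    congr 3
    have h : S.settingOp y (-e) * S.settingOp y (d • e) = S.settingOp y ((d - 1) • e) := by
      rw [settingOp_mul S hm]
      congr 1
      funext i
      simp [Nat.cast_sub (Nat.one_le_iff_ne_zero.mpr hd)]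
      ring
    rw [← h, settingOp_order S hm hd, mul_one]

end Realization

theorem IsUnitaryOfOrder.norm_apply {H : Type*} [NormedAddCommGroup H] [InnerProductSpace ℂ H]
    {d : ℕ} (hd : d ≠ 0) {X : Module.End ℂ H} (h : IsUnitaryOfOrder d X) (v : H) :
    ‖X v‖ = ‖v‖ := by
  have e : inner ℂ (X v) (X v) = inner ℂ v v := by
    rw [h.inner_left, ← Module.End.mul_apply, ← pow_succ,
      Nat.sub_add_cancel (Nat.one_le_iff_ne_zero.mpr hd), h.pow_eq_one]
    rfl
  rw [inner_self_eq_norm_sq_to_K, inner_self_eq_norm_sq_to_K] at e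
  have e' : ‖X v‖ ^ 2 = ‖v‖ ^ 2 := by exact_mod_cast e
  exact (sq_eq_sq₀ (norm_nonneg _) (norm_nonneg _)).mp e'

theorem IsUnitaryOfOrder.pow {H : Type*} [NormedAddCommGroup H] [InnerProductSpace ℂ H]
    {d : ℕ} {X : Module.End ℂ H} (h : IsUnitaryOfOrder d X) (k : ℕ) :
    IsUnitaryOfOrder d (X ^ k) where
  pow_eq_one := by rw [← pow_mul, mul_comm, pow_mul, h.pow_eq_one, one_pow]
  inner_left v w := by
    rw [← pow_mul, mul_comm, pow_mul]
    induction k generalizing v w with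
    | zero => simp
    | succ k ih =>
      rw [pow_succ, Module.End.mul_apply, ih, h.inner_left, pow_succ', Module.End.mul_apply]

/-- The first party. -/
def firstParty {N : ℕ} (hN : 2 ≤ N) : Fin N := ⟨0, by omega⟩

/-- The position of the first entry of `(α_1, …, α_{N-1})`. -/
def firstIndex {N : ℕ} (hN : 2 ≤ N) : Fin (N - 1) := ⟨0, by omega⟩

theorem sum_apply_zero {N m : ℕ} (hN : 2 ≤ N) (f : Fin m → ℝ) :
    ∑ α : Fin (N - 1) → Fin m, f (α (firstIndex hN)) = m ^ (N - 2) * ∑ z, f z := by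
  obtain ⟨n, rfl⟩ : ∃ n, N = n + 2 := ⟨N - 2, by omega⟩
  change ∑ α : Fin (n + 1) → Fin m, f (α 0) = _
  rw [← (Fin.consEquiv (fun _ : Fin (n + 1) => Fin m)).sum_comp, Fintype.sum_prod_type,
    Finset.mul_sum]
  simp [Fin.consEquiv]

-- The sum-of-squares decomposition of the Bell value

namespace Realization

variable {N m d : ℕ} (S : Realization.{u} N m d)

/-- The settings of the parties in the term with index `α` of the ASTA expression. -/
def termSetting {N m : ℕ} (α : Fin (N - 1) → Fin m) (i : Fin N) : ℕ :=
  if (i : ℕ) = 0 then settingIndex α 0 else settingIndex α ((i : ℕ) - 1) + settingIndex α i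

/-- The exponents `(-1)^i` of the parties other than the first one. -/
def restExponent {N : ℕ} (i : Fin N) : ℤ := if (i : ℕ) = 0 then 0 else (-1) ^ (i : ℕ)

/-- The unitary `A_{i,α_{i-1}+α_i-1}^{(-1)^{i-1}}` of all parties but the first. -/
def restOp (α : Fin (N - 1) → Fin m) : Module.End ℂ S.Space :=
  S.op (S.settingOp (termSetting α) restExponent)

/-- The unitary `A_{i,z}^e` of a single party. -/
def partyOp (i : Fin N) (z : ℕ) (e : ℤ) : Module.End ℂ S.Space :=
  S.op (S.settingOp (fun _ => z) (Pi.single i e))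

theorem partyOp_pow (hm : 0 < m) (i : Fin N) (z : ℕ) (e : ℤ) (k : ℕ) :
    S.partyOp i z e ^ k = S.partyOp i z (k * e) := by
  rw [partyOp, op_settingOp_pow S hm, partyOp, ← Pi.single_smul]
  simp

theorem settingOp_single (i : Fin N) (z : ℕ) (e : ℤ) :
    S.settingOp (fun _ => z) (Pi.single i e) =
      Function.update (1 : ∀ i, Matrix (Fin (S.dim i)) (Fin (S.dim i)) ℂ) i
        (S.extObservable i z ^ e) := by
  funext j
  rcases eq_or_ne j i with rfl | h
  · simp [settingOp]
  · simp [settingOp, h]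

theorem partyOp_add_period (hm : 0 < m) (i : Fin N) (z : ℕ) (e : ℤ) :
    S.partyOp i (z + m) e = omegaPow d e • S.partyOp i z e := by
  have h : S.extObservable i (z + m) ^ e =
      omegaPow d e • S.extObservable i z ^ e + (0 : ℂ) • S.extObservable i z ^ e := by
    rw [zero_smul, add_zero, extObservable_zpow S hm, extObservable_zpow S hm, spec, spec,
      Finset.smul_sum]
    have h1 : (⟨(z + m) % m, Nat.mod_lt _ hm⟩ : Fin m) = ⟨z % m, Nat.mod_lt _ hm⟩ := by
      simp
    rw [h1]
    refine Finset.sum_congr rfl fun b _ => ?_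
    rw [smul_smul]
    congr 1
    have h2 : eigenvalue m d (z + m) b = omegaPow d 1 * eigenvalue m d z b := by
      rw [eigenvalue, eigenvalue, ← omegaPow_add, Nat.add_div_right _ hm]
      congr 1
      push_cast
      ring
    rw [Pi.pow_apply, Pi.pow_apply, h2, mul_zpow, ← omegaPow_mul_int, one_mul]
  rw [partyOp, partyOp, settingOp_single, settingOp_single, h, op_update_add, zero_smul, add_zero]

theorem isUnitaryOfOrder_partyOp (hm : 0 < m) (hd : d ≠ 0) (i : Fin N) (z : ℕ) (e : ℤ) :
    IsUnitaryOfOrder d (S.partyOp i z e) := isUnitaryOfOrder_op_settingOp S hm hd _ _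

theorem inner_partyOp (hm : 0 < m) (i : Fin N) (z : ℕ) (e : ℤ) (v w : S.Space) :
    inner ℂ v (S.partyOp i z e w) = inner ℂ (S.partyOp i z (-e) v) w := by
  rw [partyOp, partyOp, inner_op_left, settingOp_conjTranspose S hm, ← Pi.single_neg, neg_neg]

variable (hN : 2 ≤ N)

/-- The vector `(a_k A_{1,z}^k + a_k^* A_{1,z+1}^k)^* ψ` of the first party. -/
def firstVec (k z : ℕ) : S.Space :=
  conj (coeffA m d k) • (S.partyOp (firstParty hN) z (-1) ^ k) S.state +
    coeffA m d k • (S.partyOp (firstParty hN) (z + 1) (-1) ^ k) S.state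

/-- The factor of the first party is moved to the left slot of the inner product, so each term
becomes an overlap of a first-party vector with a unit vector made by the rest. -/
theorem expectation_astaFactor (hm : 0 < m) (α : Fin (N - 1) → Fin m) (k : ℕ) :
    S.expectation (S.astaFactor α k) =
      inner ℂ (S.firstVec hN k (α (firstIndex hN))) ((S.restOp α ^ k) S.state) := by
  have hα : settingIndex α 0 = α (firstIndex hN) := by
    rw [settingIndex, dif_pos (show 0 < N - 1 by omega)]
    rfl
  have h1 : S.astaFactor α k = Function.update (S.settingOp (termSetting α) (k • restExponent))
      (firstParty hN) (coeffA m d k • S.extObservable (firstParty hN) (settingIndex α 0) ^ (k : ℤ) +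
        conj (coeffA m d k) •
          S.extObservable (firstParty hN) (settingIndex α 0 + 1) ^ (k : ℤ)) := by
    funext i
    by_cases hi : (i : ℕ) = 0
    · have hi' : i = firstParty hN := Fin.ext hi
      subst hi'
      simp only [Function.update_self, zpow_natCast]
      rw [astaFactor, if_pos hi]
    · have : i ≠ (firstParty hN) := fun h => hi (by rw [h]; rfl)
      rw [Function.update_of_ne this, astaFactor, if_neg hi, settingOp, termSetting, if_neg hi]
      congr 1
      simp [restExponent, hi, mul_comm]
  have h2 : ∀ z, S.op (Function.update (S.settingOp (termSetting α) (k • restExponent))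
      (firstParty hN) (S.extObservable (firstParty hN) z ^ (k : ℤ))) =
      S.partyOp (firstParty hN) z k * S.restOp α ^ k := by
    intro z
    rw [restOp, op_settingOp_pow S hm, partyOp, ← map_mul, settingOp_single]
    congr 1
    funext i
    rcases eq_or_ne i (firstParty hN) with rfl | h
    · simp [settingOp, restExponent, firstParty]
    · simp [h]
  rw [expectation, ← op_apply, h1, op_update_add, h2, h2, LinearMap.add_apply,
    LinearMap.smul_apply, LinearMap.smul_apply, inner_add_right, inner_smul_right,
    inner_smul_right, Module.End.mul_apply, Module.End.mul_apply, inner_partyOp S hm,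
    inner_partyOp S hm, firstVec, inner_add_left, inner_smul_left, inner_smul_left,
    Complex.conj_conj, hα, partyOp_pow S hm, partyOp_pow S hm]
  simp

/-- The first party's vectors `A_{1,z}^{-k} ψ` with phases which make the chain antiperiodic. -/
def chainVec (k z : ℕ) : S.Space :=
  omegaPow d ((2 * (k : ℝ) - d) / (2 * m) * z) •
    (S.partyOp (firstParty hN) z (-1) ^ k) S.state

theorem norm_chainVec (hm : 0 < m) (hd : d ≠ 0) (k z : ℕ) : ‖S.chainVec hN k z‖ = 1 := by
  rw [chainVec, norm_smul, norm_omegaPow, one_mul,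
    ((isUnitaryOfOrder_partyOp S hm hd _ _ _).pow k).norm_apply hd, S.norm_state]

/-- After $m$ steps the phase contributes $\omega^{k-d/2}$ and the convention $A_{z+m}=\omega A_z$
contributes $\omega^{-k}$; together $\omega^{-d/2}=-1$. -/
theorem chainVec_period (hm : 0 < m) (hd : d ≠ 0) (k : ℕ) :
    S.chainVec hN k m = -S.chainVec hN k 0 := by
  have hm0 : (m : ℝ) ≠ 0 := by positivity
  have h := partyOp_add_period S hm (firstParty hN) 0 (-1)
  rw [zero_add] at h
  rw [chainVec, chainVec, h, smul_pow, LinearMap.smul_apply, smul_smul, ← omegaPow_mul_nat,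
    ← omegaPow_add, ← neg_one_smul ℂ (omegaPow d _ • _), smul_smul]
  congr 1
  have e : (2 * (k : ℝ) - d) / (2 * m) * m + ((-1 : ℤ) : ℝ) * k = -(d * 1 / (2 * (1 : ℕ))) := by
    push_cast; field_simp; ring
  have e2 : omegaPow d (d * 1 / (2 * (1 : ℕ))) = -1 := by
    rw [omegaPow_half hd]
    simp
  have := omegaPow_mul_neg d (d * 1 / (2 * (1 : ℕ)))
  rw [e2] at this
  rw [e, Nat.cast_zero, mul_zero, omegaPow_zero]
  linear_combination -this

/-- Extracting the phase at the midpoint $z+\tfrac12$ leaves $\omega^{\mp(2k-d)/4m}$ on the two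
neighbours, the phases of $a_k^*$ and $a_k$. -/
theorem two_cos_smul_firstVec (hm : 2 ≤ m) (k z : ℕ) :
    ((2 * Real.cos (Real.pi / (2 * m)) : ℝ) : ℂ) • S.firstVec hN k z =
      omegaPow d (-((2 * (k : ℝ) - d) / (2 * m) * (z + 1 / 2))) •
        (S.chainVec hN k z + S.chainVec hN k (z + 1)) := by
  have hm0 : (m : ℝ) ≠ 0 := by positivity
  have h1 := coeffA_mul hm d k
  have h2 := congrArg conj h1
  rw [map_mul, Complex.conj_ofReal, conj_omegaPow] at h2
  rw [firstVec, chainVec, chainVec, smul_add, smul_add, smul_smul, smul_smul, smul_smul, smul_smul,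
    mul_comm _ (conj _), mul_comm _ (coeffA m d k), h1, h2, ← omegaPow_add, ← omegaPow_add]
  congr 3
  · field_simp; ring
  · push_cast; field_simp; ring

theorem norm_firstVec (hm : 2 ≤ m) (k z : ℕ) :
    (2 * Real.cos (Real.pi / (2 * m))) ^ 2 * ‖S.firstVec hN k z‖ ^ 2 =
      ‖S.chainVec hN k z + S.chainVec hN k (z + 1)‖ ^ 2 := by
  have h := congrArg (fun v => ‖v‖ ^ 2) (two_cos_smul_firstVec S hN hm k z)
  simp only [norm_smul, norm_omegaPow, one_mul, mul_pow, Complex.norm_real, Real.norm_eq_abs,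
    sq_abs] at h
  rw [← h]; ring

theorem sum_norm_firstVec_le (hm : 2 ≤ m) (hd : d ≠ 0) (k : ℕ) :
    ∑ z ∈ Finset.range m, ‖S.firstVec hN k z‖ ^ 2 ≤ m := by
  have h := sum_norm_add_sq_chain_le_complex hm
    (fun j _ => S.norm_chainVec hN (by omega) hd k j) (S.chainVec_period hN (by omega) hd k)
  simp only [← norm_firstVec S hN hm, ← Finset.mul_sum] at h
  have := cos_pi_div_two_mul_pos hm
  rw [mul_comm] at h
  exact le_of_mul_le_mul_right h (by positivity)

/-- Equality in the chain bound gives $v_z+2v_{z+1}+v_{z+2}=(2+2\cos\frac\pi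
m)v_{z+1}=(2\cos\frac\pi{2m})^2v_{z+1}$. Undoing the phases recovers the first party's unitary from
two neighbouring combinations. -/
theorem partyOp_state_eq (hm : 2 ≤ m) (hd : d ≠ 0) (k : ℕ)
    (h : m ≤ ∑ z ∈ Finset.range m, ‖S.firstVec hN k z‖ ^ 2) {z : ℕ} (hz : z + 2 ≤ m) :
    (S.partyOp (firstParty hN) (z + 1) (-1) ^ k) S.state =
      conj (coeffA m d k) • S.firstVec hN k z + coeffA m d k • S.firstVec hN k (z + 1) := by
  have hm0 : (m : ℝ) ≠ 0 := by positivity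
  have hc := cos_pi_div_two_mul_pos hm
  have hrec := chain_recurrence_complex hm
    (fun j _ => S.norm_chainVec hN (by omega) hd k j) (S.chainVec_period hN (by omega) hd k)
    (by
      simp only [← norm_firstVec S hN hm, ← Finset.mul_sum]
      rw [mul_comm]
      exact mul_le_mul_of_nonneg_left h (by positivity)) hz
  set C : ℂ := ((2 * Real.cos (Real.pi / (2 * m)) : ℝ) : ℂ) with hC
  have hC0 : C ≠ 0 := by
    rw [hC]; exact_mod_cast (by positivity : 2 * Real.cos (Real.pi / (2 * m)) ≠ 0)
  have hC2 : C ^ 2 = 2 + ((2 * Real.cos (Real.pi / m) : ℝ) : ℂ) := by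
    have e : Real.pi / m = 2 * (Real.pi / (2 * m)) := by field_simp
    rw [e, Real.cos_two_mul, hC]
    push_cast
    ring
  set x := (2 * (k : ℝ) - d) / (2 * m) with hx
  have h1 := coeffA_mul hm d k
  have h2 := congrArg conj h1
  rw [map_mul, Complex.conj_ofReal, conj_omegaPow] at h2
  have hx' : (2 * (k : ℝ) - d) / (4 * m) = x / 2 := by rw [hx]; field_simp; ring
  rw [← hC, hx'] at h1 h2
  have key : C ^ 2 • (S.partyOp (firstParty hN) (z + 1) (-1) ^ k) S.state =
      C ^ 2 • (conj (coeffA m d k) • S.firstVec hN k z +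
        coeffA m d k • S.firstVec hN k (z + 1)) := by
    have e1 : C ^ 2 • (conj (coeffA m d k) • S.firstVec hN k z +
        coeffA m d k • S.firstVec hN k (z + 1)) =
        (conj (coeffA m d k) * C) • (C • S.firstVec hN k z) +
          (coeffA m d k * C) • (C • S.firstVec hN k (z + 1)) := by
      module
    have e2 : S.chainVec hN k z + S.chainVec hN k (z + 1) +
        (S.chainVec hN k (z + 1) + S.chainVec hN k (z + 1 + 1)) =
        C ^ 2 • S.chainVec hN k (z + 1) := by
      rw [hC2, add_smul, ← hrec, two_smul]
      abel
    rw [e1, hC, two_cos_smul_firstVec S hN hm, two_cos_smul_firstVec S hN hm, ← hC, h1, h2,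
      smul_smul, smul_smul, ← omegaPow_add, ← omegaPow_add, ← hx]
    have e3 : -(x / 2) + -(x * ((z : ℝ) + 1 / 2)) = -(x * (z + 1)) := by ring
    have e4 : x / 2 + -(x * (((z + 1 : ℕ) : ℝ) + 1 / 2)) = -(x * (z + 1)) := by push_cast; ring
    rw [e3, e4, ← smul_add, e2, chainVec, ← hx, smul_comm, smul_smul (omegaPow d _)]
    have e5 : x * ((z + 1 : ℕ) : ℝ) = x * (z + 1) := by push_cast; ring
    rw [e5, mul_comm, omegaPow_mul_neg, one_smul]
  exact smul_right_injective _ (pow_ne_zero 2 hC0) key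

/-- Each term is completed to a square: $\operatorname{Re}\langle
u,w\rangle+\frac12\|u-w\|^2=\frac12\|u\|^2+\frac12$ for a unit vector $w$. Summing over $\alpha$
repeats each $\|u\|^2$ of the first party $m^{N-2}$ times, and the chain bound controls their sum
over $z$. -/
theorem astaValue_add_defect (hm : 2 ≤ m) (hd : d ≠ 0) :
    S.astaValue + ∑ α : Fin (N - 1) → Fin m, ∑ k ∈ Finset.Ico 1 d,
        ‖S.firstVec hN k (α (firstIndex hN)) - (S.restOp α ^ k) S.state‖ ^ 2 / 2 +
      ∑ k ∈ Finset.Ico 1 d, (m : ℝ) ^ (N - 2) *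
        (m - ∑ z ∈ Finset.range m, ‖S.firstVec hN k z‖ ^ 2) / 2 =
    (m : ℝ) ^ (N - 1) * (d - 1) := by
  have hterm : ∀ (α : Fin (N - 1) → Fin m) (k : ℕ),
      (S.expectation (S.astaFactor α k)).re +
        ‖S.firstVec hN k (α (firstIndex hN)) - (S.restOp α ^ k) S.state‖ ^ 2 / 2 =
      ‖S.firstVec hN k (α (firstIndex hN))‖ ^ 2 / 2 + 1 / 2 := by
    intro α k
    rw [expectation_astaFactor S hN (by omega), @norm_sub_sq ℂ,
      ((isUnitaryOfOrder_op_settingOp S (by omega) hd _ _).pow k).norm_apply hd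
        (X := S.restOp α ^ k),
      S.norm_state]
    change (inner ℂ _ _ : ℂ).re + (_ - 2 * (inner ℂ _ _ : ℂ).re + _) / 2 = _
    ring
  have hsum : ∀ k, ∑ α : Fin (N - 1) → Fin m,
      (‖S.firstVec hN k (α (firstIndex hN))‖ ^ 2 / 2 + 1 / 2) =
      (m : ℝ) ^ (N - 2) * (∑ z ∈ Finset.range m, ‖S.firstVec hN k z‖ ^ 2) / 2 +
        (m : ℝ) ^ (N - 1) / 2 := by
    intro k
    rw [sum_apply_zero hN (fun z : Fin m => ‖S.firstVec hN k z‖ ^ 2 / 2 + 1 / 2),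
      Fin.sum_univ_eq_sum_range (fun z => ‖S.firstVec hN k z‖ ^ 2 / 2 + 1 / 2),
      Finset.sum_add_distrib, ← Finset.sum_div]
    have : (m : ℝ) ^ (N - 1) = m ^ (N - 2) * m := by
      rw [← pow_succ]; congr 1; omega
    rw [this]
    simp
    ring
  rw [astaValue, Complex.re_sum]
  simp only [Complex.re_sum]
  rw [← Finset.sum_add_distrib]
  simp only [← Finset.sum_add_distrib, hterm]
  rw [Finset.sum_comm, ← Finset.sum_add_distrib]
  simp only [hsum]
  have : ∀ k, (m : ℝ) ^ (N - 2) * (∑ z ∈ Finset.range m, ‖S.firstVec hN k z‖ ^ 2) / 2 +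
        (m : ℝ) ^ (N - 1) / 2 + (m : ℝ) ^ (N - 2) *
        (m - ∑ z ∈ Finset.range m, ‖S.firstVec hN k z‖ ^ 2) / 2 = (m : ℝ) ^ (N - 1) := by
    intro k
    have : (m : ℝ) ^ (N - 1) = m ^ (N - 2) * m := by
      rw [← pow_succ]; congr 1; omega
    rw [this]; ring
  simp only [this]
  rw [Finset.sum_const, Nat.card_Ico, nsmul_eq_mul, Nat.cast_sub (Nat.one_le_iff_ne_zero.mpr hd)]
  push_cast
  ring

theorem relations_of_maximal (hm : 2 ≤ m) (hd : d ≠ 0)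
    (hmax : (m : ℝ) ^ (N - 1) * (d - 1) ≤ S.astaValue) {k : ℕ} (hk : 1 ≤ k) (hkd : k < d) :
    (∀ α : Fin (N - 1) → Fin m,
      (S.restOp α ^ k) S.state = S.firstVec hN k (α (firstIndex hN))) ∧
    m ≤ ∑ z ∈ Finset.range m, ‖S.firstVec hN k z‖ ^ 2 := by
  have h := S.astaValue_add_defect hN hm hd
  have hk' : k ∈ Finset.Ico 1 d := Finset.mem_Ico.mpr ⟨hk, hkd⟩
  have hm0 : (0 : ℝ) < m := by positivity
  have n1 : ∀ α ∈ (Finset.univ : Finset (Fin (N - 1) → Fin m)), 0 ≤ ∑ k ∈ Finset.Ico 1 d,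
      ‖S.firstVec hN k (α (firstIndex hN)) - (S.restOp α ^ k) S.state‖ ^ 2 / 2 :=
    fun α _ => Finset.sum_nonneg fun k _ => by positivity
  have n2 : ∀ k ∈ Finset.Ico 1 d, 0 ≤ (m : ℝ) ^ (N - 2) *
        (m - ∑ z ∈ Finset.range m, ‖S.firstVec hN k z‖ ^ 2) / 2 := by
    intro k _
    have := sub_nonneg.mpr (S.sum_norm_firstVec_le hN hm hd k)
    positivity
  have z1 := (Finset.sum_eq_zero_iff_of_nonneg n1).mp
    (le_antisymm (by have := Finset.sum_nonneg n2; linarith) (Finset.sum_nonneg n1))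
  have z2 := (Finset.sum_eq_zero_iff_of_nonneg n2).mp
    (le_antisymm (by have := Finset.sum_nonneg n1; linarith) (Finset.sum_nonneg n2))
  constructor
  · intro α
    have := (Finset.sum_eq_zero_iff_of_nonneg fun k _ => by positivity).mp
      (z1 α (Finset.mem_univ α)) k hk'
    rw [div_eq_zero_iff, or_iff_left two_ne_zero, sq_eq_zero_iff, norm_eq_zero, sub_eq_zero] at this
    exact this.symm
  · have := z2 k hk'
    rw [div_eq_zero_iff, or_iff_left two_ne_zero, mul_eq_zero,
      or_iff_right (pow_pos hm0 _).ne', sub_eq_zero] at this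
    exact this.le

end Realization

-- Tracelessness for every party

namespace Realization

variable {N m d : ℕ} (S : Realization.{u} N m d)

/-- If the first entries of `α` and `β` are the adjacent settings `z` and `z + 1`, maximal violation
yields the relations of two commuting pairs on the cut between the first party and the rest. -/
theorem cut_relations (hN : 2 ≤ N) (hm : 2 ≤ m) (hd : d ≠ 0)
    (hmax : (m : ℝ) ^ (N - 1) * (d - 1) ≤ S.astaValue) {z : ℕ} (hz : z + 2 ≤ m)
    {α β : Fin (N - 1) → Fin m} (hα : (α (firstIndex hN) : ℕ) = z)
    (hβ : (β (firstIndex hN) : ℕ) = z + 1) {k : ℕ} (hk : 1 ≤ k) (hkd : k < d) :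
    (S.restOp α ^ k) S.state =
      conj (coeffA m d k) • (S.partyOp (firstParty hN) z (-1) ^ k) S.state +
        coeffA m d k • (S.partyOp (firstParty hN) (z + 1) (-1) ^ k) S.state ∧
    (S.partyOp (firstParty hN) (z + 1) (-1) ^ k) S.state =
      conj (coeffA m d k) • (S.restOp α ^ k) S.state +
        coeffA m d k • (S.restOp β ^ k) S.state := by
  obtain ⟨h1, h2⟩ := S.relations_of_maximal hN hm hd hmax hk hkd
  constructor
  · rw [h1, hα, firstVec]
  · rw [h1, h1, hα, hβ]
    exact S.partyOp_state_eq hN hm hd k h2 hz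

/-- Inverting the observable only exchanges the exponents $k$ and $d-k$. -/
theorem inner_partyOp_eq_zero_of_sign (hm : 0 < m) (hd : d ≠ 0) (i : Fin N) (x : ℕ) {s : ℤ}
    (hs : s = 1 ∨ s = -1) {F : Module.End ℂ S.Space}
    (h : ∀ k, 1 ≤ k → k < d → inner ℂ S.state (F ((S.partyOp i x s ^ k) S.state)) = 0)
    {k : ℕ} (hk : 1 ≤ k) (hkd : k < d) :
    inner ℂ S.state (F (S.partyOp i x k S.state)) = 0 := by
  rcases hs with rfl | rfl
  · have := h k hk hkd
    rwa [partyOp_pow S hm, mul_one] at this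
  · have := h (d - k) (by omega) (by omega)
    have e : S.partyOp i x (-1) ^ (d - k) = S.partyOp i x k := by
      have h1 : S.partyOp i x (-1) ^ k * S.partyOp i x k = 1 := by
        rw [partyOp_pow S hm, partyOp, partyOp, ← map_mul, settingOp_mul S hm, ← Pi.single_add]
        simp [settingOp_zero]
      calc S.partyOp i x (-1) ^ (d - k)
          = S.partyOp i x (-1) ^ (d - k) * (S.partyOp i x (-1) ^ k * S.partyOp i x k) := by
            rw [h1, mul_one]
        _ = _ := by
            rw [← mul_assoc, ← pow_add, Nat.sub_add_cancel hkd.le,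
              (S.isUnitaryOfOrder_partyOp hm hd i x (-1)).pow_eq_one, one_mul]
    rwa [e] at this

theorem isUnitaryOfOrder_restOp (hm : 0 < m) (hd : d ≠ 0) (α : Fin (N - 1) → Fin m) :
    IsUnitaryOfOrder d (S.restOp α) := S.isUnitaryOfOrder_op_settingOp hm hd _ _

theorem partyOp_commute_eveOp (i : Fin N) (x : ℕ) (k : ℤ) (E : S.Eve →L[ℂ] S.Eve) :
    Commute (S.partyOp i x k) (S.eveOp E) := S.op_commute_eveOp _ E

theorem restOp_commute_eveOp (α : Fin (N - 1) → Fin m) (E : S.Eve →L[ℂ] S.Eve) :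
    Commute (S.restOp α) (S.eveOp E) := S.op_commute_eveOp _ E

theorem inner_partyOp_eq_zero_first (hN : 2 ≤ N) (hm : 2 ≤ m) (hd : 2 ≤ d)
    (hmax : (m : ℝ) ^ (N - 1) * (d - 1) ≤ S.astaValue) {x : ℕ} (hx : x < m)
    (E : S.Eve →L[ℂ] S.Eve) {k : ℕ} (hk : 1 ≤ k) (hkd : k < d) :
    inner ℂ S.state (S.eveOp E (S.partyOp (firstParty hN) x k S.state)) = 0 := by
  have hm0 : 0 < m := by omega
  have hd0 : d ≠ 0 := by omega
  -- Every setting belongs to a pair $z,z+1$ inside the range; the last setting must be the upper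
  -- member. Constant index families suffice for this cut.
  obtain ⟨z, hz, hxz⟩ : ∃ z, z + 2 ≤ m ∧ (x = z ∨ x = z + 1) := by
    by_cases h : x + 2 ≤ m
    · exact ⟨x, h, Or.inl rfl⟩
    · exact ⟨x - 1, by omega, Or.inr (by omega)⟩
  refine S.inner_partyOp_eq_zero_of_sign hm0 hd0 _ x (Or.inr rfl) (fun k hk hkd => ?_) hk hkd
  have hrel := fun k (hk : 1 ≤ k) (hkd : k < d) => S.cut_relations hN hm hd0 hmax hz
    (α := fun _ => ⟨z, by omega⟩) (β := fun _ => ⟨z + 1, by omega⟩) rfl rfl hk hkd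
  have hcomm : ∀ (y : ℕ) (α : Fin (N - 1) → Fin m),
      Commute (S.partyOp (firstParty hN) y (-1)) (S.restOp α) := by
    intro y α
    refine (S.settingOp_commute hm0 fun i => ?_).map S.op
    by_cases h : (i : ℕ) = 0
    · exact Or.inr (Or.inl (by simp [restExponent, h]))
    · exact Or.inl (Pi.single_eq_of_ne (fun h' => h (by rw [h']; rfl)) _)
  have h := inner_pow_eq_zero_of_bipartite hm hd (F := S.eveOp E) (ψ := S.state)
    (A := S.partyOp (firstParty hN) z (-1)) (B := S.partyOp (firstParty hN) (z + 1) (-1))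
    (X := S.restOp fun _ => ⟨z, by omega⟩) (Y := S.restOp fun _ => ⟨z + 1, by omega⟩)
    (S.isUnitaryOfOrder_partyOp hm0 hd0 (firstParty hN) z (-1))
    (S.isUnitaryOfOrder_partyOp hm0 hd0 (firstParty hN) (z + 1) (-1))
    (S.isUnitaryOfOrder_restOp hm0 hd0 _) (S.isUnitaryOfOrder_restOp hm0 hd0 _)
    (hcomm _ _) (hcomm _ _) (hcomm _ _) (hcomm _ _) (S.partyOp_commute_eveOp _ _ _ E)
    (S.partyOp_commute_eveOp _ _ _ E) (S.restOp_commute_eveOp _ E) (S.restOp_commute_eveOp _ E)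
    (fun k h1 h2 => (hrel k h1 h2).1) (fun k h1 h2 => (hrel k h1 h2).2) hk hkd
  rcases hxz with rfl | rfl
  exacts [h.1, h.2.1]

/-- A family of settings whose entries before position `i` alternate between `z` and `z + 1`. -/
def alternating {m : ℕ} (N : ℕ) {z : ℕ} (hz : z + 2 ≤ m) (i e : ℕ) (j : Fin (N - 1)) : Fin m :=
  if (j : ℕ) < i then ⟨z + (j + e) % 2, by omega⟩ else ⟨0, by omega⟩

theorem settingIndex_alternating {m N z : ℕ} (hz : z + 2 ≤ m) {i : ℕ} (hi : i < N) (e j : ℕ) :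
    settingIndex (alternating N hz i e) j = if j < i then z + (j + e) % 2 else 0 := by
  unfold settingIndex alternating
  split_ifs <;> first | rfl | omega

/-- The cut is now party $i$ against all others. The relations between the first party and the rest
are multiplied by a unitary that strips every party but $i$ from the rest, provided that these
parties use the same settings in both relations. -/
theorem inner_partyOp_eq_zero_rest (hN : 2 ≤ N) (hm : 2 ≤ m) (hd : 2 ≤ d)
    (hmax : (m : ℝ) ^ (N - 1) * (d - 1) ≤ S.astaValue) {i : Fin N} (hi : (i : ℕ) ≠ 0)
    {x : ℕ} (hx : x < m) (E : S.Eve →L[ℂ] S.Eve) {k : ℕ} (hk : 1 ≤ k) (hkd : k < d) :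
    inner ℂ S.state (S.eveOp E (S.partyOp i x k S.state)) = 0 := by
  have hm0 : 0 < m := by omega
  have hd0 : d ≠ 0 := by omega
  obtain ⟨z, hz, hxz⟩ : ∃ z, z + 2 ≤ m ∧ (x = z ∨ x = z + 1) := by
    by_cases h : x + 2 ≤ m
    · exact ⟨x, h, Or.inl rfl⟩
    · exact ⟨x - 1, by omega, Or.inr (by omega)⟩
  have hs : ((-1 : ℤ) ^ (i : ℕ) = 1 ∨ (-1 : ℤ) ^ (i : ℕ) = -1) := neg_one_pow_eq_or ℤ i
  set s : ℤ := (-1) ^ (i : ℕ) with hsdef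
  refine S.inner_partyOp_eq_zero_of_sign hm0 hd0 _ x hs (fun k hk hkd => ?_) hk hkd
  -- The alternating families swap $z$ and $z+1$, so every party strictly between the first and $i$
  -- has index sum $2z+1$ in both, and the parties after $i$ have sum $0$. Only the settings of the
  -- first party and of $i$ change.
  set α := alternating N hz i 0 with hα
  set β := alternating N hz i 1 with hβ
  have hiα : ∀ e j, settingIndex (alternating N hz i e) j = if j < i then z + (j + e) % 2 else 0 :=
    settingIndex_alternating hz i.2
  have hfirst : ∀ e, settingIndex (alternating N hz i e) 0 =
      alternating N hz i e (firstIndex hN) := fun e => by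
    rw [settingIndex, dif_pos (show 0 < N - 1 by omega)]
    rfl
  have hα0 : (α (firstIndex hN) : ℕ) = z := by
    rw [hα, ← hfirst, hiα, if_pos (by omega)]
    simp
  have hβ0 : (β (firstIndex hN) : ℕ) = z + 1 := by
    rw [hβ, ← hfirst, hiα, if_pos (by omega)]
  have hrel := fun k (hk : 1 ≤ k) (hkd : k < d) => S.cut_relations hN hm hd0 hmax hz
    hα0 hβ0 hk hkd
  have hyα : termSetting α i = z + (i - 1) % 2 := by
    rw [termSetting, if_neg hi, hα, hiα, hiα, if_pos (by omega), if_neg (by omega)]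
    rfl
  have hyβ : termSetting β i = z + (i - 1 + 1) % 2 := by
    rw [termSetting, if_neg hi, hβ, hiα, hiα, if_pos (by omega), if_neg (by omega)]
    rfl
  have hy : ∀ j : Fin N, (j : ℕ) ≠ 0 → j ≠ i → termSetting β j = termSetting α j := by
    intro j hj hji
    have : (j : ℕ) ≠ i := fun h => hji (Fin.ext h)
    rw [termSetting, termSetting, if_neg hj, if_neg hj, hα, hβ, hiα, hiα, hiα, hiα]
    split_ifs <;> omega
  have hy0 : ∀ j : Fin N, (j : ℕ) = 0 → termSetting α j = z ∧ termSetting β j = z + 1 := by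
    intro j hj
    rw [termSetting, termSetting, if_pos hj, if_pos hj, hα, hβ, hfirst, hfirst]
    exact ⟨hα0, hβ0⟩
  -- `r` undoes the parties other than the first and $i$; `e` adds the inverse observable of the
  -- first party.
  let r : Fin N → ℤ := fun j => if (j : ℕ) = 0 ∨ j = i then 0 else -(-1) ^ (j : ℕ)
  let e : Fin N → ℤ := fun j => if (j : ℕ) = 0 then -1 else r j
  have hXk : ∀ (y : Fin N → ℕ) (k : ℕ), S.op (S.settingOp y (Pi.single i s)) ^ k =
      S.partyOp i (y i) s ^ k := by
    intro y k
    congr 2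
    refine S.settingOp_congr fun j => ⟨rfl, fun h => ?_⟩
    rcases eq_or_ne j i with rfl | h'
    · rfl
    · simp [h'] at h
  have hG : ∀ (k : ℕ) (γ : Fin (N - 1) → Fin m), (γ = α ∨ γ = β) →
      S.op (S.settingOp (termSetting α) (k • r)) * S.restOp γ ^ k =
        S.op (S.settingOp (termSetting γ) (Pi.single i s)) ^ k := by
    intro k γ hγ
    have e1 : S.settingOp (termSetting α) (k • r) = S.settingOp (termSetting γ) (k • r) := by
      refine S.settingOp_congr fun j => ⟨rfl, fun h => ?_⟩
      rcases hγ with rfl | rfl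
      · rfl
      · have h' : ¬ ((j : ℕ) = 0 ∨ j = i) := by
          intro h'
          simp [r, h'] at h
        push Not at h'
        exact (hy j h'.1 h'.2).symm
    rw [e1, restOp, op_settingOp_pow S hm0, op_settingOp_pow S hm0, ← map_mul, settingOp_mul S hm0]
    congr 2
    funext j
    rcases eq_or_ne j i with rfl | h
    · simp [r, restExponent, hi, hsdef]
    · by_cases h0 : (j : ℕ) = 0
      · simp [r, restExponent, h0, h]
      · simp [r, restExponent, h0, h]
  have hA : ∀ (k : ℕ) (γ : Fin (N - 1) → Fin m) (y : ℕ),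
      (γ = α ∧ y = z ∨ γ = β ∧ y = z + 1) →
      S.op (S.settingOp (termSetting α) (k • r)) * S.partyOp (firstParty hN) y (-1) ^ k =
        S.op (S.settingOp (termSetting γ) e) ^ k := by
    intro k γ y hγ
    rw [partyOp, op_settingOp_pow S hm0, op_settingOp_pow S hm0, ← map_mul]
    congr 1
    funext j
    by_cases h0 : (j : ℕ) = 0
    · obtain rfl : j = firstParty hN := Fin.ext h0
      have : termSetting γ (firstParty hN) = y := by
        rcases hγ with ⟨rfl, rfl⟩ | ⟨rfl, rfl⟩
        exacts [(hy0 _ h0).1, (hy0 _ h0).2]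
      simp [settingOp, r, e, h0, this]
    · have hj : j ≠ firstParty hN := fun h => h0 (by rw [h]; rfl)
      by_cases hji : j = i
      · have hr : r j = 0 := by simp [r, hji]
        have he : e j = 0 := by simp [e, h0, hr]
        simp [settingOp, hr, he, hj]
      · have : termSetting γ j = termSetting α j := by
          rcases hγ with ⟨rfl, rfl⟩ | ⟨rfl, rfl⟩
          exacts [rfl, hy j h0 hji]
        simp [settingOp, r, e, hj, h0, hji, this]
  have hcomm : ∀ γ δ : Fin (N - 1) → Fin m, Commute (S.op (S.settingOp (termSetting γ) e))
      (S.op (S.settingOp (termSetting δ) (Pi.single i s))) := by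
    intro γ δ
    refine (S.settingOp_commute hm0 fun j => ?_).map S.op
    rcases eq_or_ne j i with rfl | h
    · exact Or.inl (by simp [e, r, hi])
    · exact Or.inr (Or.inl (by simp [h]))
  have h := inner_pow_eq_zero_of_bipartite hm hd (F := S.eveOp E) (ψ := S.state)
    (A := S.op (S.settingOp (termSetting α) e)) (B := S.op (S.settingOp (termSetting β) e))
    (X := S.op (S.settingOp (termSetting α) (Pi.single i s)))
    (Y := S.op (S.settingOp (termSetting β) (Pi.single i s)))
    (S.isUnitaryOfOrder_op_settingOp hm0 hd0 _ _) (S.isUnitaryOfOrder_op_settingOp hm0 hd0 _ _)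
    (S.isUnitaryOfOrder_op_settingOp hm0 hd0 _ _) (S.isUnitaryOfOrder_op_settingOp hm0 hd0 _ _)
    (hcomm _ _) (hcomm _ _) (hcomm _ _) (hcomm _ _) (S.op_commute_eveOp _ E)
    (S.op_commute_eveOp _ E) (S.op_commute_eveOp _ E) (S.op_commute_eveOp _ E)
    (by
      intro k h1 h2
      rw [← hG k α (Or.inl rfl), ← hA k α z (Or.inl ⟨rfl, rfl⟩),
        ← hA k β (z + 1) (Or.inr ⟨rfl, rfl⟩), Module.End.mul_apply, (hrel k h1 h2).1, map_add,
        map_smul, map_smul]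
      rfl)
    (by
      intro k h1 h2
      rw [← hG k α (Or.inl rfl), ← hG k β (Or.inr rfl),
        ← hA k β (z + 1) (Or.inr ⟨rfl, rfl⟩), Module.End.mul_apply, (hrel k h1 h2).2, map_add,
        map_smul, map_smul]
      rfl) hk hkd
  rw [hXk, hXk, hyα, hyβ] at h
  -- The parity of the position decides which of the two families gives party $i$ the setting $z$
  -- and which $z+1$.
  rcases Nat.mod_two_eq_zero_or_one ((i : ℕ) - 1) with h2 | h2
  · have h3 : ((i : ℕ) - 1 + 1) % 2 = 1 := by omega
    rw [h2, h3] at h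
    rcases hxz with rfl | rfl
    exacts [h.2.2.1, h.2.2.2]
  · have h3 : ((i : ℕ) - 1 + 1) % 2 = 0 := by omega
    rw [h2, h3] at h
    rcases hxz with rfl | rfl
    exacts [h.2.2.2, h.2.2.1]

/-- Nontrivial powers of the observables are traceless on the part of any operator of the
eavesdropper. -/
theorem inner_partyOp_eq_zero (hN : 2 ≤ N) (hm : 2 ≤ m) (hd : 2 ≤ d)
    (hmax : (m : ℝ) ^ (N - 1) * (d - 1) ≤ S.astaValue) (i : Fin N) {x : ℕ} (hx : x < m)
    (E : S.Eve →L[ℂ] S.Eve) {k : ℕ} (hk : 1 ≤ k) (hkd : k < d) :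
    inner ℂ S.state (S.eveOp E (S.partyOp i x k S.state)) = 0 := by
  by_cases hi : (i : ℕ) = 0
  · obtain rfl : i = firstParty hN := Fin.ext hi
    exact S.inner_partyOp_eq_zero_first hN hm hd hmax hx E hk hkd
  · exact S.inner_partyOp_eq_zero_rest hN hm hd hmax hi hx E hk hkd

end Realization

-- Fourier inversion and Eve's guessing value

theorem sum_omegaPow {d : ℕ} (hd : d ≠ 0) (n : ℤ) :
    ∑ k : Fin d, omegaPow d (n * (k : ℕ)) = if (d : ℤ) ∣ n then (d : ℂ) else 0 := by
  rw [Fin.sum_univ_eq_sum_range fun k => omegaPow d (n * (k : ℕ))]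
  simp only [omegaPow_mul_nat]
  have hprim : IsPrimitiveRoot (omegaPow d 1) d := by
    have := Complex.isPrimitiveRoot_exp d hd
    rwa [show omegaPow d 1 = Complex.exp (2 * Real.pi * Complex.I / d) by simp [omegaPow]]
  have hn : omegaPow d n = omegaPow d 1 ^ n := by rw [← omegaPow_mul_int, one_mul]
  split_ifs with h
  · rw [hn, (hprim.zpow_eq_one_iff_dvd n).mpr h]
    simp
  · have h1 : omegaPow d n ≠ 1 := fun h' => h ((hprim.zpow_eq_one_iff_dvd n).mp (hn ▸ h'))
    rw [geom_sum_eq h1, ← omegaPow_mul_nat, mul_comm, omegaPow_self_mul hd, sub_self, zero_div]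

namespace Realization

variable {N m d : ℕ} (S : Realization.{u} N m d)

/-- The representation of operators of a single party on the global Hilbert space. -/
def localOp (i : Fin N) : Matrix (Fin (S.dim i)) (Fin (S.dim i)) ℂ →ₗ[ℂ] Module.End ℂ S.Space where
  toFun X := S.op (Pi.mulSingle i X)
  map_add' X Y := by simpa [Pi.mulSingle] using S.op_update_add 1 i 1 1 X Y
  map_smul' c X := by simpa [Pi.mulSingle] using S.op_update_add 1 i c 0 X X

theorem localOp_extObservable_zpow (i : Fin N) (x : ℕ) (k : ℤ) :
    S.localOp i (S.extObservable i x ^ k) = S.partyOp i x k := by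
  rw [partyOp, settingOp_single]
  rfl

theorem Q_eq_sum (hd : d ≠ 0) (i : Fin N) (x : Fin m) (b : Fin d) :
    S.Q i x b = (d : ℂ)⁻¹ • ∑ k : Fin d,
      omegaPow d (-((b : ℕ) * (k : ℕ))) • S.extObservable i x ^ ((k : ℕ) : ℤ) := by
  have hm : 0 < m := x.pos
  have hx : (⟨(x : ℕ) % m, Nat.mod_lt _ hm⟩ : Fin m) = x := Fin.ext (Nat.mod_eq_of_lt x.2)
  have hd' : (d : ℂ) ≠ 0 := by exact_mod_cast hd
  simp only [extObservable_zpow S hm, hx, spec, Finset.smul_sum, smul_smul]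
  rw [Finset.sum_comm]
  simp only [← Finset.sum_smul, ← Finset.mul_sum]
  have h : ∀ c : Fin d, ∑ k : Fin d, omegaPow d (-((b : ℕ) * (k : ℕ))) *
      (eigenvalue m d x ^ ((k : ℕ) : ℤ)) c = if c = b then (d : ℂ) else 0 := by
    intro c
    have h1 : ∀ k : Fin d, omegaPow d (-((b : ℕ) * (k : ℕ))) *
        (eigenvalue m d x ^ ((k : ℕ) : ℤ)) c = omegaPow d (((c : ℤ) - b : ℤ) * (k : ℕ)) := by
      intro k
      rw [zpow_natCast, Pi.pow_apply, eigenvalue, Nat.div_eq_of_lt x.2, ← omegaPow_mul_nat,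
        ← omegaPow_add]
      congr 1
      push_cast
      ring
    simp only [h1]
    rw [sum_omegaPow hd]
    congr 1
    rw [eq_iff_iff]
    constructor
    · intro h
      have := Int.eq_zero_of_abs_lt_dvd h (by rw [abs_lt]; omega)
      exact Fin.ext (by omega)
    · rintro rfl
      simp
  simp only [h]
  simp [hd']

/-- In the Fourier expansion of the projections only $k=0$ survives, leaving $\langle
E^{(b)}\rangle/d$; completeness of Eve's measurement does the rest. -/
theorem guessValue_eq (hN : 2 ≤ N) (hm : 2 ≤ m) (hd : 2 ≤ d)
    (hmax : (m : ℝ) ^ (N - 1) * (d - 1) ≤ S.astaValue) (i : Fin N) (x : Fin m)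
    {E : Fin d → S.Eve →L[ℂ] S.Eve} (hE : ∑ b, E b = 1) :
    S.guessValue i x E = 1 / d := by
  have hterm : ∀ b : Fin d, inner ℂ S.state
      (S.applyParties (Pi.mulSingle i (S.Q i x b)) (S.applyEve (E b) S.state)) =
      (d : ℂ)⁻¹ * inner ℂ S.state (S.applyEve (E b) S.state) := by
    intro b
    change inner ℂ S.state (S.localOp i (S.Q i x b) (S.eveOp (E b) S.state)) = _
    rw [Q_eq_sum S (by omega), map_smul, map_sum, LinearMap.smul_apply, LinearMap.sum_apply,
      inner_smul_right, inner_sum]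
    congr 1
    rw [Finset.sum_eq_single (⟨0, by omega⟩ : Fin d)]
    · simp only [map_smul, localOp_extObservable_zpow, LinearMap.smul_apply]
      have : S.partyOp i x ((0 : ℕ) : ℤ) = 1 := by
        rw [partyOp, Nat.cast_zero, Pi.single_zero, settingOp_zero, map_one]
      rw [this]
      simp
      rfl
    · intro k _ hk
      have hk' : (k : ℕ) ≠ 0 := fun h => hk (Fin.ext h)
      rw [map_smul, localOp_extObservable_zpow, LinearMap.smul_apply, inner_smul_right,
        ← Module.End.mul_apply, (S.partyOp_commute_eveOp i x k (E b)).eq, Module.End.mul_apply,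
        S.inner_partyOp_eq_zero hN hm hd hmax i x.2 (E b) (by omega) k.2, mul_zero]
    · simp
  have hsum : ∑ b, S.applyEve (E b) S.state = S.state := by
    ext j
    simp only [WithLp.ofLp_sum, Finset.sum_apply]
    change ∑ b, E b (S.state j) = S.state j
    rw [← sum_apply, hE]
    rfl
  rw [guessValue, ← Complex.re_sum]
  simp only [hterm]
  rw [← Finset.mul_sum, ← inner_sum, hsum, inner_self_eq_norm_sq_to_K, S.norm_state]
  simp

-- The correlations determine the Bell value

theorem applyParties_sum_smul {κ : Type*} [Fintype κ] [DecidableEq κ] (c : Fin N → κ → ℂ)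
    (P : ∀ i, κ → Matrix (Fin (S.dim i)) (Fin (S.dim i)) ℂ) (v : S.Space) :
    S.applyParties (fun i => ∑ b, c i b • P i b) v =
      ∑ b : Fin N → κ, (∏ i, c i (b i)) • S.applyParties (fun i => P i (b i)) v := by
  ext j
  simp only [WithLp.ofLp_sum, Finset.sum_apply, PiLp.smul_apply, applyParties_apply,
    Finset.smul_sum, smul_smul]
  rw [Finset.sum_comm]
  refine Finset.sum_congr rfl fun l _ => ?_
  rw [← Finset.sum_smul]
  congr 1
  simp only [Matrix.sum_apply, Matrix.smul_apply, smul_eq_mul]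
  rw [Finset.prod_univ_sum, Fintype.piFinset_univ]
  simp only [Finset.prod_mul_distrib]

theorem expectation_Q (x : Fin N → Fin m) (b : Fin N → Fin d) :
    S.expectation (fun i => S.Q i (x i) (b i)) = S.behaviour x b := by
  rw [behaviour, eq_comm, ← Complex.conj_eq_iff_re, expectation, inner_conj_symm, ← op_apply,
    inner_op_left]
  simp only [(S.isHermitian_Q _ _ _).eq]

theorem expectation_settingOp (hm : 0 < m) (y : Fin N → ℕ) (e : Fin N → ℤ) :
    S.expectation (S.settingOp y e) = ∑ b : Fin N → Fin d,
      (∏ i, eigenvalue m d (y i) (b i) ^ e i) *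
        S.behaviour (fun i => ⟨y i % m, Nat.mod_lt _ hm⟩) b := by
  have h : S.settingOp y e = fun i => ∑ b : Fin d, eigenvalue m d (y i) b ^ e i •
      S.Q i ⟨y i % m, Nat.mod_lt _ hm⟩ b := by
    funext i
    rw [settingOp, extObservable_zpow S hm]
    rfl
  rw [h, expectation, applyParties_sum_smul, inner_sum]
  simp only [inner_smul_right, ← expectation_Q]
  rfl

/-- The exponents `(-1)^i` of all parties. -/
def signExponent {N : ℕ} (i : Fin N) : ℤ := (-1) ^ (i : ℕ)

/-- Splitting the first party's factor leaves two correlators of products of observables, which are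
Fourier transforms of the correlations. -/
theorem expectation_astaFactor_eq (hN : 2 ≤ N) (α : Fin (N - 1) → Fin m) (k : ℕ) :
    S.expectation (S.astaFactor α k) =
      coeffA m d k * S.expectation (S.settingOp (termSetting α) (k • signExponent)) +
      conj (coeffA m d k) * S.expectation (S.settingOp
        (termSetting α + Pi.single (firstParty hN) 1) (k • signExponent)) := by
  have h1 : S.astaFactor α k = Function.update (S.settingOp (termSetting α) (k • signExponent))
      (firstParty hN) (coeffA m d k • S.extObservable (firstParty hN) (settingIndex α 0) ^ k +
        conj (coeffA m d k) • S.extObservable (firstParty hN) (settingIndex α 0 + 1) ^ k) := by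
    funext i
    by_cases hi : (i : ℕ) = 0
    · have hi' : i = firstParty hN := Fin.ext hi
      subst hi'
      rw [Function.update_self, astaFactor, if_pos hi]
    · have : i ≠ firstParty hN := fun h => hi (by rw [h]; rfl)
      rw [Function.update_of_ne this, astaFactor, if_neg hi, settingOp, termSetting, if_neg hi]
      congr 1
      simp [signExponent, mul_comm]
  have h2 : ∀ n : ℕ, Function.update (S.settingOp (termSetting α) (k • signExponent))
      (firstParty hN) (S.extObservable (firstParty hN) (settingIndex α 0 + n) ^ k) =
      S.settingOp (termSetting α + Pi.single (firstParty hN) n) (k • signExponent) := by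
    intro n
    funext i
    rcases eq_or_ne i (firstParty hN) with rfl | h
    · simp [settingOp, signExponent, firstParty, termSetting]
      exact (zpow_natCast _ _).symm
    · simp [settingOp, h]
  have h3 := h2 0
  simp only [add_zero, Pi.single_zero] at h3
  rw [expectation, ← op_apply, h1, op_update_add, h3, h2 1, LinearMap.add_apply,
    LinearMap.smul_apply, LinearMap.smul_apply, inner_add_right, inner_smul_right,
    inner_smul_right]
  rfl

theorem astaValue_congr (hN : 2 ≤ N) (hm : 0 < m) {S T : Realization.{u} N m d}
    (h : T.behaviour = S.behaviour) : T.astaValue = S.astaValue := by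
  simp only [astaValue, expectation_astaFactor_eq _ hN, expectation_settingOp _ hm, h]

end Realization

-- The GHZ realization attains the bound

section GHZ

variable {ι : Type*} [Fintype ι] {E : Type*} [NormedAddCommGroup E]

/-- The unnormalized GHZ vector `∑_q |q, …, q⟩ ⊗ w`. -/
def diagVec (ι : Type*) [Fintype ι] (d : ℕ) (w : E) : PiLp 2 (fun _ : ι → Fin d => E) :=
  WithLp.toLp 2 fun j => ∑ q : Fin d, if j = (fun _ => q) then w else 0

theorem diagVec_apply (d : ℕ) (w : E) (j : ι → Fin d) :
    diagVec ι d w j = ∑ q : Fin d, if j = (fun _ => q) then w else 0 := rfl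

variable [DecidableEq ι] [InnerProductSpace ℂ E]

theorem inner_diagVec (d : ℕ) (w : E) (v : PiLp 2 (fun _ : ι → Fin d => E)) :
    inner ℂ (diagVec ι d w) v = ∑ q : Fin d, inner ℂ w (v fun _ => q) := by
  simp only [PiLp.inner_apply, diagVec_apply, sum_inner]
  rw [Finset.sum_comm]
  refine Finset.sum_congr rfl fun q _ => ?_
  rw [Finset.sum_eq_single (fun _ => q)]
  · simp
  · intro j _ hj
    simp [hj]
  · simp

theorem sum_smul_diagVec (d : ℕ) (w : E) (c : (ι → Fin d) → ℂ) :
    ∑ l, c l • diagVec ι d w l = (∑ q : Fin d, c fun _ => q) • w := by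
  simp only [diagVec_apply, Finset.smul_sum, Finset.sum_smul]
  rw [Finset.sum_comm]
  refine Finset.sum_congr rfl fun q _ => ?_
  rw [Finset.sum_eq_single (fun _ => q)]
  · simp
  · intro j _ hj
    simp [hj]
  · simp

theorem norm_diagVec [Nonempty ι] (d : ℕ) (w : E) : ‖diagVec ι d w‖ ^ 2 = d * ‖w‖ ^ 2 := by
  have h : inner ℂ (diagVec ι d w) (diagVec ι d w) = ((d * ‖w‖ ^ 2 : ℝ) : ℂ) := by
    rw [inner_diagVec]
    have : ∀ q : Fin d, diagVec ι d w (fun _ => q) = w := by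
      intro q
      rw [diagVec_apply, Finset.sum_eq_single q]
      · simp
      · intro r _ hr
        rw [if_neg]
        intro h
        exact hr (congrFun h (Classical.arbitrary ι)).symm
      · simp
    simp only [this, inner_self_eq_norm_sq_to_K]
    simp
  rw [inner_self_eq_norm_sq_to_K] at h
  exact Complex.ofReal_injective (by simpa using h)

end GHZ

/-- The phase parameter of setting `x` of party `i` in the optimal realization. -/
def ghzPhase {N : ℕ} (m : ℕ) (i : Fin N) (y : ℕ) : ℝ :=
  (y : ℝ) / m - if (i : ℕ) = 0 then (1 : ℝ) / (2 * m) else 0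

/-- The optimal measurements on the GHZ state. -/
def ghzQ {N : ℕ} (m d : ℕ) (i : Fin N) (x : Fin m) (b : Fin d) : Matrix (Fin d) (Fin d) ℂ :=
  Matrix.of fun q q' => (d : ℂ)⁻¹ *
    omegaPow d ((Realization.signExponent i : ℝ) * (ghzPhase m i x - (b : ℕ)) *
      (((q' : ℤ) - (q : ℤ) : ℤ) : ℝ))

theorem ghzQ_apply {N m d : ℕ} (i : Fin N) (x : Fin m) (b q q' : Fin d) :
    ghzQ m d i x b q q' = (d : ℂ)⁻¹ *
    omegaPow d ((Realization.signExponent i : ℝ) * (ghzPhase m i x - (b : ℕ)) *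
      (((q' : ℤ) - (q : ℤ) : ℤ) : ℝ)) := rfl

theorem signExponent_eq {N : ℕ} (i : Fin N) :
    Realization.signExponent i = 1 ∨ Realization.signExponent i = -1 := neg_one_pow_eq_or ℤ _

theorem dvd_signExponent_mul {N : ℕ} (i : Fin N) (d n : ℤ) :
    d ∣ Realization.signExponent i * n ↔ d ∣ n := by
  rcases signExponent_eq i with h | h <;> simp [h]

/-- Fourier sum over the outcomes of the optimal measurements. -/
theorem sum_eigenvalue_mul_ghzQ {N m d : ℕ} (hm : 0 < m) (hd : d ≠ 0) (i : Fin N) (y : ℕ) (k : ℤ)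
    (q q' : Fin d) :
    ∑ b : Fin d, Realization.eigenvalue m d y b ^ (k * Realization.signExponent i) *
        ghzQ m d i ⟨y % m, Nat.mod_lt y hm⟩ b q q' =
      if (d : ℤ) ∣ k - ((q' : ℤ) - q) then
        omegaPow d (Realization.signExponent i * ghzPhase m i y * (((q' : ℤ) - (q : ℤ) : ℤ) : ℝ))
      else 0 := by
  have hd' : (d : ℂ) ≠ 0 := by exact_mod_cast hd
  have hm' : (m : ℝ) ≠ 0 := by exact_mod_cast hm.ne'
  set s := Realization.signExponent i with hs
  set n : ℤ := (q' : ℤ) - q with hn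
  have hy : (y : ℝ) = m * (y / m : ℕ) + (y % m : ℕ) := by exact_mod_cast (Nat.div_add_mod y m).symm
  have hph : ghzPhase m i y = ghzPhase m i (y % m) + (y / m : ℕ) := by
    rw [ghzPhase, ghzPhase]
    nth_rewrite 1 [hy]
    field_simp
    ring
  have hterm : ∀ b : Fin d, Realization.eigenvalue m d y b ^ (k * s) *
      ghzQ m d i ⟨y % m, Nat.mod_lt y hm⟩ b q q' =
      ((d : ℂ)⁻¹ * (omegaPow d (s * ghzPhase m i y * n) *
        omegaPow d (((y / m : ℕ) * s * (k - n) : ℤ) : ℝ))) *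
        omegaPow d ((s * (k - n) : ℤ) * (b : ℕ)) := by
    intro b
    rw [Realization.eigenvalue, ← omegaPow_mul_int, ghzQ_apply, ← hs, ← hn, mul_left_comm,
      ← omegaPow_add, mul_assoc (_ : ℂ)⁻¹, ← omegaPow_add, ← omegaPow_add, hph]
    congr 2
    simp only [Int.cast_mul, Int.cast_sub, Int.cast_natCast]
    ring
  simp only [hterm]
  rw [← Finset.mul_sum, sum_omegaPow hd]
  simp only [hs, dvd_signExponent_mul]
  split_ifs with h
  · obtain ⟨t, ht⟩ := h
    have : (((y / m : ℕ) * Realization.signExponent i * (k - n) : ℤ) : ℝ) =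
        d * (((y / m : ℕ) * Realization.signExponent i * t : ℤ) : ℝ) := by
      rw [ht]; push_cast; ring
    rw [this, omegaPow_self_mul hd, mul_one]
    field_simp
  · rw [mul_zero]

/-- The GHZ state with the optimal measurements; the eavesdropper is uncorrelated. -/
def ghz {N m d : ℕ} (hN : 2 ≤ N) (hm : 0 < m) (hd : d ≠ 0) : Realization.{u} N m d where
  dim _ := d
  Eve := EuclideanSpace ℂ PUnit.{u + 1}
  state := diagVec (Fin N) d
    (((Real.sqrt d)⁻¹ : ℂ) • EuclideanSpace.single PUnit.unit (1 : ℂ))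
  norm_state := by
    have : Nonempty (Fin N) := ⟨⟨0, by omega⟩⟩
    have hd' : (0 : ℝ) < d := by exact_mod_cast Nat.pos_of_ne_zero hd
    rw [← sq_eq_sq₀ (norm_nonneg _) zero_le_one, norm_diagVec, norm_smul]
    simp [inv_pow, Real.sq_sqrt hd'.le, hd'.ne']
  Q := ghzQ m d
  isHermitian_Q i x b := by
    ext q q'
    rw [Matrix.conjTranspose_apply, ghzQ_apply, ghzQ_apply]
    simp only [RCLike.star_def, map_mul, map_inv₀, Complex.conj_natCast, conj_omegaPow]
    congr 2
    push_cast
    ring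
  idempotent_Q i x b := by
    have hd' : (d : ℂ) ≠ 0 := by exact_mod_cast hd
    ext q q'
    rw [Matrix.mul_apply]
    have : ∀ r : Fin d, ghzQ m d i x b q r * ghzQ m d i x b r q' =
        (d : ℂ)⁻¹ * ghzQ m d i x b q q' := by
      intro r
      rw [ghzQ_apply, ghzQ_apply, ghzQ_apply, mul_mul_mul_comm, ← omegaPow_add, mul_assoc]
      congr 3
      push_cast
      ring
    simp [this, hd']
  sum_Q i x := by
    ext q q'
    rw [Matrix.sum_apply]
    have h := sum_eigenvalue_mul_ghzQ hm hd i (x : ℕ) 0 q q'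
    have hx : (⟨(x : ℕ) % m, Nat.mod_lt _ hm⟩ : Fin m) = x := Fin.ext (Nat.mod_eq_of_lt x.2)
    simp only [zero_mul, zpow_zero, one_mul, hx] at h
    rw [h, Matrix.one_apply]
    rcases eq_or_ne q q' with rfl | hqq
    · simp
    · rw [if_neg, if_neg hqq]
      intro h
      have := Int.eq_zero_of_abs_lt_dvd h (by rw [abs_lt]; omega)
      exact hqq (Fin.ext (by omega))

theorem ghz_expectation {N m d : ℕ} (hN : 2 ≤ N) (hm : 0 < m) (hd : d ≠ 0)
    (M : Fin N → Matrix (Fin d) (Fin d) ℂ) :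
    (ghz.{u} hN hm hd).expectation M = (d : ℂ)⁻¹ * ∑ q : Fin d, ∑ q' : Fin d, ∏ i, M i q q' := by
  have hd' : (0 : ℝ) < d := by exact_mod_cast Nat.pos_of_ne_zero hd
  refine (inner_diagVec (ι := Fin N) d _
    ((ghz.{u} hN hm hd).applyParties M (ghz.{u} hN hm hd).state)).trans ?_
  have : ∀ q : Fin d, (ghz.{u} hN hm hd).applyParties M (ghz.{u} hN hm hd).state (fun _ => q) =
      (∑ q' : Fin d, ∏ i, M i q q') • (((Real.sqrt d)⁻¹ : ℂ) •
        (EuclideanSpace.single PUnit.unit (1 : ℂ) : EuclideanSpace ℂ PUnit.{u + 1})) := fun q =>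
    sum_smul_diagVec d _ fun l => ∏ i, M i q (l i)
  have hw : ∀ c : ℂ, inner ℂ (((Real.sqrt d)⁻¹ : ℂ) •
      (EuclideanSpace.single PUnit.unit (1 : ℂ) : EuclideanSpace ℂ PUnit.{u + 1}))
      (c • ((Real.sqrt d)⁻¹ : ℂ) • EuclideanSpace.single PUnit.unit (1 : ℂ)) = (d : ℂ)⁻¹ * c := by
    intro c
    rw [inner_smul_right, inner_self_eq_norm_sq_to_K, norm_smul, mul_comm]
    congr 1
    simp
    rw [← Complex.ofReal_pow, sq_abs, Real.sq_sqrt hd'.le]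
    simp
  rw [Finset.mul_sum]
  exact Finset.sum_congr rfl fun q _ => (congrArg _ (this q)).trans (hw _)

/-- For all parties alike, these powers are weighted cyclic shifts by $k$; the signs enter only
through the phases, which therefore add up over the parties. -/
theorem ghz_settingOp_apply {N m d : ℕ} (hN : 2 ≤ N) (hm : 0 < m) (hd : d ≠ 0) (y : Fin N → ℕ)
    (k : ℕ) (i : Fin N) (q q' : Fin d) :
    (ghz.{u} hN hm hd).settingOp y (k • Realization.signExponent) i q q' =
      if (d : ℤ) ∣ k - ((q' : ℤ) - q) then
        omegaPow d (Realization.signExponent i * ghzPhase m i (y i) *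
          (((q' : ℤ) - (q : ℤ) : ℤ) : ℝ))
      else 0 := by
  rw [← sum_eigenvalue_mul_ghzQ hm hd, Realization.settingOp,
    Realization.extObservable_zpow _ hm, Realization.spec]
  refine (Matrix.sum_apply (m := Fin d) (n := Fin d) q q' _ _).trans ?_
  refine Finset.sum_congr rfl fun b _ => ?_
  rfl

/-- The alternating sum of $\alpha_{i-1}+\alpha_i$ telescopes, the fixed last index contributes $0$,
and the offset of the first party remains. -/
theorem sum_signExponent_termSetting {N m : ℕ} (hN : 2 ≤ N) (α : Fin (N - 1) → Fin m) :
    ∑ i : Fin N, (Realization.signExponent i : ℝ) * ghzPhase m i (Realization.termSetting α i) =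
      -(1 / (2 * m)) := by
  have key : ∀ n : ℕ, ∑ i ∈ Finset.range (n + 1), (-1 : ℝ) ^ i *
      ((if i = 0 then settingIndex α 0 else settingIndex α (i - 1) + settingIndex α i : ℕ) / m -
        if i = 0 then (1 : ℝ) / (2 * m) else 0) =
      (-1) ^ n * settingIndex α n / m - 1 / (2 * m) := by
    intro n
    induction n with
    | zero => simp
    | succ n ih =>
      rw [Finset.sum_range_succ, ih]
      simp
      ring
  have h := key (N - 1)
  have h0 : settingIndex α (N - 1) = 0 := by simp [settingIndex]
  rw [Nat.sub_add_cancel (by omega), h0] at h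
  rw [← Fin.sum_univ_eq_sum_range (fun i => (-1 : ℝ) ^ i *
      ((if i = 0 then settingIndex α 0 else settingIndex α (i - 1) + settingIndex α i : ℕ) / m -
        if i = 0 then (1 : ℝ) / (2 * m) else 0))] at h
  simp only [Realization.signExponent, ghzPhase, Realization.termSetting]
  push_cast at h ⊢
  rw [h]
  simp

/-- For either value of $n$ the two phases become $\omega^{\pm d/4m}$, whose sum is $2\cos(\pi/2m)$,
the denominator of $a_k$. -/
theorem coeffA_mul_omegaPow_add {m d k : ℕ} (hm : 2 ≤ m) (hd : d ≠ 0) (n : ℤ)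
    (hn : n = k ∨ n = k - d) :
    coeffA m d k * omegaPow d (-(1 / (2 * m)) * n) +
      conj (coeffA m d k) * omegaPow d (1 / (2 * m) * n) = 1 := by
  have hm0 : (m : ℝ) ≠ 0 := by positivity
  have hc := cos_pi_div_two_mul_pos hm
  set C : ℂ := ((2 * Real.cos (Real.pi / (2 * m)) : ℝ) : ℂ) with hC
  have hC0 : C ≠ 0 := by
    rw [hC]; exact_mod_cast (by positivity : 2 * Real.cos (Real.pi / (2 * m)) ≠ 0)
  have h1 := coeffA_mul hm d k
  have h2 := congrArg conj h1
  rw [map_mul, Complex.conj_ofReal, conj_omegaPow] at h2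
  rw [← hC] at h1 h2
  have h3 := omegaPow_add_neg hd m (1 / 2)
  have e : Real.pi / m * (1 / 2) = Real.pi / (2 * m) := by ring
  rw [e, ← hC] at h3
  have key : (coeffA m d k * omegaPow d (-(1 / (2 * m)) * n) +
      conj (coeffA m d k) * omegaPow d (1 / (2 * m) * n)) * C = C := by
    rw [add_mul, mul_right_comm, h1, mul_right_comm, h2, ← omegaPow_add, ← omegaPow_add]
    rcases hn with rfl | rfl
    · rw [add_comm]
      refine Eq.trans ?_ h3
      congr 2
      · push_cast; field_simp; ring
      · push_cast; field_simp; ring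
    · refine Eq.trans ?_ h3
      congr 2
      · push_cast; field_simp; ring
      · push_cast; field_simp; ring
  exact mul_right_cancel₀ hC0 (by rw [key, one_mul])

theorem ghz_expectation_astaFactor {N m d : ℕ} (hN : 2 ≤ N) (hm : 2 ≤ m) (hd : d ≠ 0)
    (α : Fin (N - 1) → Fin m) {k : ℕ} (hkd : k < d) :
    (ghz.{u} hN (by omega : 0 < m) hd).expectation
      ((ghz.{u} hN (by omega : 0 < m) hd).astaFactor α k) = 1 := by
  have hd' : (d : ℂ) ≠ 0 := by exact_mod_cast hd
  have hm0 : (m : ℝ) ≠ 0 := by positivity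
  have : Nonempty (Fin N) := ⟨⟨0, by omega⟩⟩
  have hprod : ∀ (y : Fin N → ℕ) (q q' : Fin d),
      ∏ i, (ghz.{u} hN (by omega : 0 < m) hd).settingOp y (k • Realization.signExponent) i q q' =
      if (d : ℤ) ∣ k - ((q' : ℤ) - q) then
        omegaPow d ((∑ i, (Realization.signExponent i : ℝ) * ghzPhase m i (y i)) *
          (((q' : ℤ) - (q : ℤ) : ℤ) : ℝ))
      else 0 := by
    intro y q q'
    simp only [ghz_settingOp_apply]
    split_ifs with h
    · rw [Finset.sum_mul]
      have : ∀ (s : Finset (Fin N)) (f : Fin N → ℝ),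
          ∏ i ∈ s, omegaPow d (f i) = omegaPow d (∑ i ∈ s, f i) := by
        intro s f
        induction s using Finset.cons_induction with
        | empty => simp
        | cons a s ha ih => rw [Finset.prod_cons, Finset.sum_cons, omegaPow_add, ih]
      exact this _ _
    · rw [Finset.prod_const, zero_pow (by simp; omega)]
  have hshift : ∑ i : Fin N, (Realization.signExponent i : ℝ) * ghzPhase m i
      ((Realization.termSetting α + Pi.single (firstParty hN) 1 : Fin N → ℕ) i) = 1 / (2 * m) := by
    have h : ∀ i : Fin N, (Realization.signExponent i : ℝ) * ghzPhase m i
        ((Realization.termSetting α + Pi.single (firstParty hN) 1 : Fin N → ℕ) i) =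
        Realization.signExponent i * ghzPhase m i (Realization.termSetting α i) +
          if i = firstParty hN then 1 / (m : ℝ) else 0 := by
      intro i
      rcases eq_or_ne i (firstParty hN) with rfl | h
      · simp [ghzPhase, Realization.signExponent, firstParty]
        ring
      · simp [h]
    simp only [h]
    rw [Finset.sum_add_distrib, sum_signExponent_termSetting hN]
    simp
    field_simp
    norm_num
  have hexp : ∀ y : Fin N → ℕ, (ghz.{u} hN (by omega : 0 < m) hd).expectation
      ((ghz.{u} hN (by omega : 0 < m) hd).settingOp y (k • Realization.signExponent)) =
      (d : ℂ)⁻¹ * ∑ q : Fin d, ∑ q' : Fin d, if (d : ℤ) ∣ k - ((q' : ℤ) - q) then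
        omegaPow d ((∑ i, (Realization.signExponent i : ℝ) * ghzPhase m i (y i)) *
          (((q' : ℤ) - (q : ℤ) : ℤ) : ℝ))
      else 0 := fun y => (ghz_expectation hN _ hd _).trans (by simp only [← hprod])
  rw [Realization.expectation_astaFactor_eq _ hN, hexp, hexp]
  simp only [sum_signExponent_termSetting hN, hshift]
  rw [mul_left_comm, mul_left_comm (conj _), ← mul_add, Finset.mul_sum, Finset.mul_sum,
    ← Finset.sum_add_distrib]
  have hrow : ∀ q : Fin d, (coeffA m d k * ∑ q' : Fin d, (if (d : ℤ) ∣ k - ((q' : ℤ) - q) then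
        omegaPow d (-(1 / (2 * m)) * (((q' : ℤ) - (q : ℤ) : ℤ) : ℝ)) else 0) +
      conj (coeffA m d k) * ∑ q' : Fin d, (if (d : ℤ) ∣ k - ((q' : ℤ) - q) then
        omegaPow d (1 / (2 * m) * (((q' : ℤ) - (q : ℤ) : ℤ) : ℝ)) else 0)) = 1 := by
    intro q
    have hq := q.2
    -- Each row of the shift has one nonzero entry, at $q+k$ or, after wrapping around, at $q+k-d$.
    obtain ⟨p, hp, huniq⟩ : ∃ p : Fin d, ((p : ℤ) - q = k ∨ (p : ℤ) - q = k - d) ∧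
        ∀ r : Fin d, r ≠ p → ¬ (d : ℤ) ∣ k - ((r : ℤ) - q) := by
      have aux : ∀ p : Fin d, ((p : ℤ) - q = k ∨ (p : ℤ) - q = k - d) →
          ∀ r : Fin d, r ≠ p → ¬ (d : ℤ) ∣ k - ((r : ℤ) - q) := by
        intro p hp r hr hdvd
        have h1 : (d : ℤ) ∣ (p : ℤ) - r := by
          rcases hp with hp | hp
          · rw [← hp] at hdvd
            convert hdvd using 1
            ring
          · have : (p : ℤ) - r = k - ((r : ℤ) - q) - d := by linear_combination hp
            rw [this]
            exact dvd_sub hdvd dvd_rfl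
        have h2 := Int.eq_zero_of_abs_lt_dvd h1 (by rw [abs_lt]; omega)
        exact hr (Fin.ext (by omega))
      by_cases h : (q : ℕ) + k < d
      · exact ⟨⟨q + k, h⟩, Or.inl (by push_cast; ring), aux _ (Or.inl (by push_cast; ring))⟩
      · have e : (((q : ℕ) + k - d : ℕ) : ℤ) - q = k - d := by omega
        exact ⟨⟨q + k - d, by omega⟩, Or.inr e, aux _ (Or.inr e)⟩
    have hdvd : (d : ℤ) ∣ k - ((p : ℤ) - q) := by
      rcases hp with hp | hp <;> rw [hp] <;> simp
    rw [Finset.sum_eq_single p (fun r _ hr => if_neg (huniq r hr)) (by simp),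
      Finset.sum_eq_single p (fun r _ hr => if_neg (huniq r hr)) (by simp), if_pos hdvd,
      if_pos hdvd]
    exact coeffA_mul_omegaPow_add hm hd _ hp
  simp only [hrow]
  simp [hd']

theorem ghz_astaValue {N m d : ℕ} (hN : 2 ≤ N) (hm : 2 ≤ m) (hd : d ≠ 0) :
    (ghz.{u} hN (by omega : 0 < m) hd).astaValue = (m : ℝ) ^ (N - 1) * (d - 1) := by
  rw [Realization.astaValue]
  have : ∀ α : Fin (N - 1) → Fin m, ∑ k ∈ Finset.Ico 1 d,
      (ghz.{u} hN (by omega : 0 < m) hd).expectation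
        ((ghz.{u} hN (by omega : 0 < m) hd).astaFactor α k) = ((d - 1 : ℕ) : ℂ) := by
    intro α
    rw [Finset.sum_congr rfl fun k hk => ghz_expectation_astaFactor hN hm hd α
      (Finset.mem_Ico.mp hk).2]
    simp
  simp only [this]
  rw [Finset.sum_const, Finset.card_univ, Fintype.card_fun, Fintype.card_fin, Fintype.card_fin,
    nsmul_eq_mul, ← Nat.cast_mul, Complex.natCast_re]
  push_cast [Nat.cast_sub (Nat.one_le_iff_ne_zero.mpr hd)]
  rfl

end ASTA
end

-- The guessing probability

theorem mainTheorem6 (N m d : ℕ) (hN : 2 ≤ N) (hm : 2 ≤ m) (hd : 2 ≤ d)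
    (S : ASTA.Realization.{u} N m d) (hS : S.MaximallyViolates)
    (i : Fin N) (x : Fin m) :
    ASTA.guessingProbability.{u} i x S.behaviour = 1 / (d : ℝ) ∧
      ASTA.certifiedBits.{u} i x S.behaviour = Real.logb 2 d := by
  have hmax : (m : ℝ) ^ (N - 1) * (d - 1) ≤ S.astaValue := by
    rw [← ASTA.ghz_astaValue.{u} hN hm (by omega)]
    exact hS _
  have hG : ASTA.guessingProbability.{u} i x S.behaviour = 1 / (d : ℝ) := by
    -- Every admissible strategy has the same value, so the supremum is over a singleton.
    have hset : {g : ℝ | ∃ T : ASTA.Realization.{u} N m d, T.behaviour = S.behaviour ∧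
        ∃ E : Fin d → T.Eve →L[ℂ] T.Eve, T.IsEvePOVM E ∧ g = T.guessValue i x E} =
        {1 / (d : ℝ)} := by
      ext g
      constructor
      · rintro ⟨T, hT, E, hE, rfl⟩
        have hTmax := ASTA.Realization.astaValue_congr hN (by omega) hT
        exact T.guessValue_eq hN hm hd (hTmax ▸ hmax) i x hE.2
      -- The value is attained by guessing uniformly at random, $E^{(b)}=1/d$, on the given
      -- realization, so the set is nonempty.
      · rintro rfl
        have hE : ∑ _b : Fin d, ((d : ℝ)⁻¹ : ℂ) • (1 : S.Eve →L[ℂ] S.Eve) = 1 := by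
          have : (d : ℂ) ≠ 0 := by exact_mod_cast (by omega : d ≠ 0)
          rw [Finset.sum_const, Finset.card_univ, Fintype.card_fin, ← Nat.cast_smul_eq_nsmul ℂ,
            smul_smul]
          simp [this]
        refine ⟨S, rfl, fun _ => ((d : ℝ)⁻¹ : ℂ) • (1 : S.Eve →L[ℂ] S.Eve), ⟨fun _ => ?_, hE⟩,
          (S.guessValue_eq hN hm hd hmax i x hE).symm⟩
        exact ContinuousLinearMap.isPositive_one.smul_of_nonneg (by
          rw [← Complex.ofReal_inv]
          exact Complex.zero_le_real.mpr (by positivity))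
    rw [ASTA.guessingProbability, hset, csSup_singleton]
  refine ⟨hG, ?_⟩
  rw [ASTA.certifiedBits, hG, one_div, Real.logb_inv, neg_neg]
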